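/- Let $\nu$ be a finite nonzero measure on a measurable space $\mathcal X$, let $t:\mathcal X\to\mathbb R^n$ be measurable with $\|t(x)\|_2\le R_2$ for all $x$, where $R_2>0$, and let $p_\theta(x)=\exp(\theta\cdot t(x)-A(\theta))$, $A(\theta)=\log\int e^{\theta\cdot t}\,d\nu$, be the exponential family with densities with respect to $\nu$. For data $z_1,\dots,z_D\in\mathcal X$ ($D\ge1$) and $\lambda\ge 0$ put $$f(\theta)=-\frac1D\sum_{i=1}^D\log p_\theta(z_i)+\frac\lambda2\|\theta\|_2^2,\qquad \bar t=\frac1D\sum_{i=1}^D t(z_i).$$ Let $\Theta\subseteq\mathbb R^n$ be closed and convex, let $\theta^*\in\arg\min_{\theta\in\Theta}f(\theta)$, let $\theta_0\in\Theta$, and let $\Pi_\Theta$ be the Euclidean projection onto $\Theta$. For each $\theta$ let $\mathbb M_\theta$ be a Markov kernel on $\mathcal X$ (measurable jointly in $\theta$ and the state) such that, for constants $C,\alpha$, $$\|\mathbb M_\theta^v q-p_\theta\|_{TV}\le C\alpha^v\quad\text{for all }\theta\in\Theta,\text{ all probability distributions }q\text{ and all }v\ge 0,$$ where $\|p-q\|_{TV}=\sup_B|p(B)-q(B)|$.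 Let $r$ be a probability distribution on $\mathcal X$, let $v\ge0$, $K\ge1$, $M$ be integers, and let $0<\delta<1$ with $M\ge 3K/\log(1/\delta)$. Then $f$ is differentiable and its gradient is $(4R_2^2+\lambda)$-Lipschitz. Moreover, let $L>0$ be any Lipschitz constant of the gradient of $f$ (for instance $L=4R_2^2+\lambda$), and for $k=1,\dots,K$, given the past, draw $x_1^{k-1},\dots,x_M^{k-1}$ independently from $q_{k-1}=\mathbb M_{\theta_{k-1}}^v r$ and set $$\theta_k=\Pi_\Theta\Big[\theta_{k-1}-\frac1L\Big(\frac1M\sum_{i=1}^M t(x_i^{k-1})-\bar t+\lambda\theta_{k-1}\Big)\Big].$$ Then, with probability at least $1-\delta$, $$f\Big(\frac1K\sum_{k=1}^K\theta_k\Big)-f(\theta^*)\le\frac{8R_2^2}{KL}\Big(\frac{L\|\theta_0-\theta^*\|_2}{4R_2}+\log\frac1\delta+\frac K{\sqrt M}+KC\alpha^v\Big)^2 .$$ -/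

import Mathlib

open MeasureTheory ProbabilityTheory

noncomputable section

namespace MCMCLearning

/-- Parameter space `ℝⁿ` with the Euclidean norm. -/
abbrev Param (n : ℕ) := EuclideanSpace ℝ (Fin n)

variable {n : ℕ} {X : Type*} [MeasurableSpace X]

/-- The log-partition function `A(θ) = log ∫ exp(θ · t(x)) dν(x)`, for the reference measure `ν`
(counting measure in the discrete case, Lebesgue measure for densities). -/
def logPartition (ν : Measure X) (t : X → Param n) (θ : Param n) : ℝ :=
  Real.log (∫ x, Real.exp (inner ℝ θ (t x)) ∂ν)

/-- The density `p_θ(x) = exp(θ · t(x) - A(θ))` with respect to `ν`. -/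
def density (ν : Measure X) (t : X → Param n) (θ : Param n) (x : X) : ℝ :=
  Real.exp (inner ℝ θ (t x) - logPartition ν t θ)

/-- The distribution with density `p_θ` with respect to `ν`. -/
def expFamily (ν : Measure X) (t : X → Param n) (θ : Param n) : Measure X :=
  ν.withDensity fun x => ENNReal.ofReal (density ν t θ x)

/-- The ridge-regularized negative log-likelihood of the data `z`. -/
def negLogLik (ν : Measure X) (t : X → Param n) (lam : ℝ) {D : ℕ} (z : Fin D → X)
    (θ : Param n) : ℝ :=
  -(1 / (D : ℝ)) * ∑ i, Real.log (density ν t θ (z i)) + lam / 2 * ‖θ‖ ^ 2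

/-- The empirical mean `t̄` of the sufficient statistics. -/
def empMean (t : X → Param n) {D : ℕ} (z : Fin D → X) : Param n :=
  (1 / (D : ℝ)) • ∑ i, t (z i)

/-- Total-variation distance `sup_A |p(A) - q(A)|` over measurable `A`. -/
def tvDist (p q : Measure X) : ℝ :=
  ⨆ A : {A : Set X // MeasurableSet A}, |p.real A - q.real A|

/-- The distribution after `v` steps of the Markov chain with kernel `T`, started from `q`. -/
def chainLaw (T : Kernel X X) (v : ℕ) (q : Measure X) : Measure X :=
  (fun p : Measure X => p.bind T)^[v] q

/-- Geometric mixing, uniformly over `θ ∈ Θ` and over all starting distributions. -/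
def FastMixing (ν : Measure X) (t : X → Param n) (T : Param n → Kernel X X)
    (Θ : Set (Param n)) (C α : ℝ) : Prop :=
  ∀ θ ∈ Θ, ∀ q : Measure X, IsProbabilityMeasure q → ∀ v : ℕ,
    tvDist (chainLaw (T θ) v q) (expFamily ν t θ) ≤ C * α ^ v

/-- Euclidean projection: a point of `Θ` nearest to `φ` (it exists and is unique whenever `Θ` is
nonempty, closed and convex). -/
def proj (Θ : Set (Param n)) (φ : Param n) : Param n :=
  Classical.epsilon fun θ => θ ∈ Θ ∧ ∀ θ' ∈ Θ, ‖θ - φ‖ ≤ ‖θ' - φ‖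

/-- `f` is differentiable and its gradient is `L`-Lipschitz in the Euclidean norm. -/
def HasLipschitzGradient (f : Param n → ℝ) (L : ℝ) : Prop :=
  Differentiable ℝ f ∧ ∀ θ φ, ‖gradient f θ - gradient f φ‖ ≤ L * ‖θ - φ‖

/-- One projected step of size `1 / L` from `θ`, with the gradient estimated from a batch `x` of
`M` samples as `(1/M) ∑ᵢ t(xᵢ) - t̄ + λ θ`. -/
def pgdStep (t : X → Param n) (tbar : Param n) (lam L : ℝ) (Θ : Set (Param n)) {M : ℕ}
    (θ : Param n) (x : Fin M → X) : Param n :=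
  proj Θ (θ - (1 / L) • ((1 / (M : ℝ)) • ∑ i, t (x i) - tbar + lam • θ))

/-- The iterates `θ₀, θ₁, …, θ_K` produced from the batches `h 0, …, h (K - 1)`: `θ_{k+1}` is
computed from `θ_k` and the batch `h k` (the sequence is constant after `K`). -/
def iter {K M : ℕ} (step : Param n → (Fin M → X) → Param n) (θ₀ : Param n)
    (h : Fin K → Fin M → X) : ℕ → Param n
  | 0 => θ₀
  | k + 1 => if hk : k < K then step (iter step θ₀ h k) (h ⟨k, hk⟩) else iter step θ₀ h k

/-- Joint law of the first `k` batches of samples: given the batches drawn so far, with current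
iterate `θ_k`, the next batch consists of `M` independent samples from `Q θ_k`. -/
def samplesLaw {M : ℕ} (step : Param n → (Fin M → X) → Param n) (θ₀ : Param n)
    (Q : Param n → Measure X) : (k : ℕ) → Measure (Fin k → Fin M → X)
  | 0 => Measure.dirac Fin.elim0
  | k + 1 => (samplesLaw step θ₀ Q k).bind fun h =>
      (Measure.pi fun _ : Fin M => Q (iter step θ₀ h k)).map
        fun x => Fin.snoc (α := fun _ => Fin M → X) h x

end MCMCLearning

end

noncomputable section

namespace MCMCLearning

/-! ### Convexity and smoothness of the regularized likelihood. -/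

section ExponentialFamily

variable {n : ℕ} {X : Type*} [MeasurableSpace X]

/-! The objective is convex and its gradient is the model mean of `t` minus `t̄` plus `λθ`, so the
algorithm is projected gradient descent with an inexact gradient. The error at a step is the batch
mean of `t` minus its mean under `p_θ`.

Convexity and smoothness alone give a deterministic bound: an error of norm `ε` enlarges the bound
on the distance to the minimizer by at most `2ε/L`, and the gap of the averaged iterate is at most
`L/(2K)` times the square of the initial distance plus `2/L` times the total error
(`inexact_projected_gradient`).

Each error splits into a bias, the difference between the means under the chain law and under `p_θ`,
and a sampling error. The bias is at most `2R` times the total variation distance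
(`norm_integral_sub_le_tvDist`). Given the past, the sampling error has mean at most `R/√M` by a
variance computation and is sub-Gaussian about that mean by a bounded-difference argument, which
controls its exponential moment at scale `1/R` (`integral_exp_norm_mean_sub_le`).

The batches are dependent through the iterates, but the conditional moment bound is uniform in `θ`,
so the moments multiply (`lintegral_batch_prod_le`). Chernoff's inequality bounds the total sampling
error with probability `1 - δ` (`samplesLaw_sum_error_le`), and on that event the deterministic
bound is the claim. -/

theorem abs_exp_sub_exp_le (a b : ℝ) :
    |Real.exp a - Real.exp b| ≤ |a - b| * (Real.exp a + Real.exp b) := by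
  wlog h : b ≤ a generalizing a b
  · rw [abs_sub_comm, abs_sub_comm a b, add_comm]
    exact this b a (le_of_not_ge h)
  have h1 := Real.add_one_le_exp (b - a)
  have h2 : Real.exp b = Real.exp a * Real.exp (b - a) := by
    rw [← Real.exp_add]; congr 1; ring
  rw [abs_of_nonneg (sub_nonneg.2 (Real.exp_le_exp.2 h)), abs_of_nonneg (sub_nonneg.2 h)]
  have h3 : Real.exp a * (b - a + 1) ≤ Real.exp b := by
    rw [h2]; exact mul_le_mul_of_nonneg_left h1 (Real.exp_pos _).le
  nlinarith [mul_nonneg (sub_nonneg.2 h) (Real.exp_pos b).le]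

/-- A measurable function with values in a ball is integrable for a finite measure. -/
theorem integrable_of_norm_le {μ : Measure X} [IsFiniteMeasure μ] {t : X → Param n}
    (ht : Measurable t) {R : ℝ} (htR : ∀ x, ‖t x‖ ≤ R) : Integrable t μ :=
  .of_bound ht.aestronglyMeasurable R (.of_forall htR)

theorem abs_inner_le {Y : Type*} {t : Y → Param n} {R : ℝ} (htR : ∀ x, ‖t x‖ ≤ R) (θ : Param n)
    (x : Y) :
    |inner ℝ θ (t x)| ≤ ‖θ‖ * R :=
  (abs_real_inner_le_norm _ _).trans (mul_le_mul_of_nonneg_left (htR x) (norm_nonneg _))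

theorem measurable_inner_stat {t : X → Param n} (ht : Measurable t) (θ : Param n) :
    Measurable fun x => inner ℝ θ (t x) := ht.const_inner

theorem integrable_inner_stat {μ : Measure X} [IsFiniteMeasure μ] {t : X → Param n}
    (ht : Measurable t) {R : ℝ} (htR : ∀ x, ‖t x‖ ≤ R) (θ : Param n) :
    Integrable (fun x => inner ℝ θ (t x)) μ :=
  .of_bound (measurable_inner_stat ht θ).aestronglyMeasurable (‖θ‖ * R)
    (.of_forall (abs_inner_le htR θ))

theorem integrable_exp_inner {μ : Measure X} [IsFiniteMeasure μ] {t : X → Param n}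
    (ht : Measurable t) {R : ℝ} (htR : ∀ x, ‖t x‖ ≤ R) (θ : Param n) :
    Integrable (fun x => Real.exp (inner ℝ θ (t x))) μ :=
  .of_bound (measurable_inner_stat ht θ).exp.aestronglyMeasurable (Real.exp (‖θ‖ * R))
    (.of_forall fun x => by
      rw [Real.norm_eq_abs, Real.abs_exp]
      exact Real.exp_le_exp.2 ((le_abs_self _).trans (abs_inner_le htR θ x)))

theorem integral_exp_inner_pos {ν : Measure X} [IsFiniteMeasure ν] (hν : ν ≠ 0) {t : X → Param n}
    (ht : Measurable t) {R : ℝ} (htR : ∀ x, ‖t x‖ ≤ R) (θ : Param n) :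
    0 < ∫ x, Real.exp (inner ℝ θ (t x)) ∂ν := by
  have : NeZero ν := ⟨hν⟩
  exact integral_exp_pos (integrable_exp_inner ht htR θ)

theorem density_eq {ν : Measure X} [IsFiniteMeasure ν] (hν : ν ≠ 0) {t : X → Param n}
    (ht : Measurable t) {R : ℝ} (htR : ∀ x, ‖t x‖ ≤ R) (θ : Param n) (x : X) :
    density ν t θ x
      = Real.exp (inner ℝ θ (t x)) / ∫ y, Real.exp (inner ℝ θ (t y)) ∂ν := by
  rw [density, Real.exp_sub, logPartition, Real.exp_log (integral_exp_inner_pos hν ht htR θ)]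

theorem measurable_density (ν : Measure X) {t : X → Param n} (ht : Measurable t) (θ : Param n) :
    Measurable (density ν t θ) :=
  ((measurable_inner_stat ht θ).sub_const _).exp

theorem integrable_density {ν : Measure X} [IsFiniteMeasure ν] (hν : ν ≠ 0) {t : X → Param n}
    (ht : Measurable t) {R : ℝ} (htR : ∀ x, ‖t x‖ ≤ R) (θ : Param n) :
    Integrable (density ν t θ) ν := by
  rw [funext (density_eq hν ht htR θ)]
  exact (integrable_exp_inner ht htR θ).div_const _

theorem integral_density {ν : Measure X} [IsFiniteMeasure ν] (hν : ν ≠ 0) {t : X → Param n}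
    (ht : Measurable t) {R : ℝ} (htR : ∀ x, ‖t x‖ ≤ R) (θ : Param n) :
    ∫ x, density ν t θ x ∂ν = 1 := by
  rw [funext (density_eq hν ht htR θ), integral_div,
    div_self (integral_exp_inner_pos hν ht htR θ).ne']

theorem isProbabilityMeasure_expFamily {ν : Measure X} [IsFiniteMeasure ν] (hν : ν ≠ 0)
    {t : X → Param n} (ht : Measurable t) {R : ℝ} (htR : ∀ x, ‖t x‖ ≤ R) (θ : Param n) :
    IsProbabilityMeasure (expFamily ν t θ) := by
  constructor
  rw [expFamily, withDensity_apply _ MeasurableSet.univ, setLIntegral_univ,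
    ← ofReal_integral_eq_lintegral_ofReal (integrable_density hν ht htR θ)
      (.of_forall fun x => (Real.exp_pos _).le), integral_density hν ht htR, ENNReal.ofReal_one]

theorem integral_expFamily {E : Type*} [NormedAddCommGroup E] [NormedSpace ℝ E] (ν : Measure X)
    {t : X → Param n} (ht : Measurable t) (θ : Param n) (g : X → E) :
    ∫ x, g x ∂(expFamily ν t θ) = ∫ x, density ν t θ x • g x ∂ν := by
  rw [expFamily, integral_withDensity_eq_integral_toReal_smul
    (measurable_density ν ht θ).ennreal_ofReal (.of_forall fun x => ENNReal.ofReal_lt_top)]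
  refine integral_congr_ae (.of_forall fun x => ?_)
  simp only [density]
  rw [ENNReal.toReal_ofReal (Real.exp_pos _).le]

/-- The mean of the sufficient statistics under `p_θ`. -/
def meanStat (ν : Measure X) (t : X → Param n) (θ : Param n) : Param n :=
  ∫ x, t x ∂(expFamily ν t θ)

theorem norm_meanStat_le {ν : Measure X} [IsFiniteMeasure ν] (hν : ν ≠ 0)
    {t : X → Param n} (ht : Measurable t) {R : ℝ} (htR : ∀ x, ‖t x‖ ≤ R) (θ : Param n) :
    ‖meanStat ν t θ‖ ≤ R := by
  have := isProbabilityMeasure_expFamily hν ht htR θ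
  simpa [meanStat] using
    norm_integral_le_of_norm_le_const (μ := expFamily ν t θ) (.of_forall htR)

/-- `exp` of the increment of the log-partition function is a moment generating function. -/
theorem exp_logPartition_sub {ν : Measure X} [IsFiniteMeasure ν] (hν : ν ≠ 0)
    {t : X → Param n} (ht : Measurable t) {R : ℝ} (htR : ∀ x, ‖t x‖ ≤ R) (θ φ : Param n) :
    Real.exp (logPartition ν t φ - logPartition ν t θ)
      = ∫ x, Real.exp (inner ℝ (φ - θ) (t x)) ∂(expFamily ν t θ) := by
  rw [integral_expFamily ν ht θ, Real.exp_sub, logPartition, logPartition,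
    Real.exp_log (integral_exp_inner_pos hν ht htR θ),
    Real.exp_log (integral_exp_inner_pos hν ht htR φ), ← integral_div]
  refine integral_congr_ae (.of_forall fun x => ?_)
  simp only [smul_eq_mul]
  rw [density_eq hν ht htR, div_mul_eq_mul_div, ← Real.exp_add]
  congr 2
  rw [← inner_add_left, add_sub_cancel]

/-- Jensen's inequality for `exp` under `p_θ`, obtained by integrating the tangent line of `exp` at
the mean `c`. It makes the model mean a subgradient before any differentiability is known. -/
theorem logPartition_ge {ν : Measure X} [IsFiniteMeasure ν] (hν : ν ≠ 0)
    {t : X → Param n} (ht : Measurable t) {R : ℝ} (htR : ∀ x, ‖t x‖ ≤ R) (θ φ : Param n) :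
    logPartition ν t θ + inner ℝ (meanStat ν t θ) (φ - θ) ≤ logPartition ν t φ := by
  have := isProbabilityMeasure_expFamily hν ht htR θ
  set p := expFamily ν t θ
  set c := inner ℝ (meanStat ν t θ) (φ - θ) with hc
  have hci : ∫ x, inner ℝ (φ - θ) (t x) ∂p = c := by
    rw [integral_inner (integrable_of_norm_le ht htR), hc, real_inner_comm]; rfl
  have hint := integrable_inner_stat (μ := p) ht htR (φ - θ)
  have key : Real.exp c ≤ Real.exp (logPartition ν t φ - logPartition ν t θ) := by
    rw [exp_logPartition_sub hν ht htR]
    calc Real.exp c = ∫ x, Real.exp c * (inner ℝ (φ - θ) (t x) - c + 1) ∂p := by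
          rw [integral_const_mul, integral_add (f := fun x => inner ℝ (φ - θ) (t x) - c)
            (hint.sub (integrable_const _)) (integrable_const _),
            integral_sub hint (integrable_const _), hci]
          simp
      _ ≤ ∫ x, Real.exp (inner ℝ (φ - θ) (t x)) ∂p := by
          refine integral_mono (((hint.sub (integrable_const _)).add (integrable_const _)).const_mul _)
            (integrable_exp_inner ht htR _) fun x => ?_
          calc _ ≤ Real.exp c * Real.exp (inner ℝ (φ - θ) (t x) - c) :=
                mul_le_mul_of_nonneg_left (Real.add_one_le_exp _) (Real.exp_pos _).le
            _ = _ := by rw [← Real.exp_add]; congr 1; ring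
  linarith [Real.exp_le_exp.1 key]

theorem abs_logPartition_sub_le {ν : Measure X} [IsFiniteMeasure ν] (hν : ν ≠ 0)
    {t : X → Param n} (ht : Measurable t) {R : ℝ} (htR : ∀ x, ‖t x‖ ≤ R) (θ φ : Param n) :
    |logPartition ν t θ - logPartition ν t φ| ≤ R * ‖θ - φ‖ := by
  have key (θ φ : Param n) : logPartition ν t θ - logPartition ν t φ ≤ R * ‖θ - φ‖ := by
    have h1 := logPartition_ge hν ht htR θ φ
    have h2 := (abs_le.1 (abs_real_inner_le_norm (meanStat ν t θ) (φ - θ))).1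
    have h3 := mul_le_mul_of_nonneg_right (norm_meanStat_le hν ht htR θ) (norm_nonneg (φ - θ))
    rw [norm_sub_rev θ φ]
    linarith
  rw [abs_sub_le_iff]
  exact ⟨key θ φ, norm_sub_rev θ φ ▸ key φ θ⟩

/-- The log-densities differ by at most `2R‖θ - φ‖`: one `R` from the statistic, one from the
log-partition function. Hence the densities differ pointwise by at most this times their sum, which
integrates to 2; the bound on `t` supplies the last factor `R`. -/
theorem norm_meanStat_sub_le {ν : Measure X} [IsFiniteMeasure ν] (hν : ν ≠ 0)
    {t : X → Param n} (ht : Measurable t) {R : ℝ} (htR : ∀ x, ‖t x‖ ≤ R)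
    (θ φ : Param n) :
    ‖meanStat ν t θ - meanStat ν t φ‖ ≤ 4 * R ^ 2 * ‖θ - φ‖ := by
  have hi (θ : Param n) : Integrable (fun x => density ν t θ x • t x) ν :=
    (integrable_density hν ht htR θ).smul_bdd R ht.aestronglyMeasurable (.of_forall htR)
  have hd (θ : Param n) := integrable_density hν ht htR θ
  rw [meanStat, meanStat, integral_expFamily ν ht, integral_expFamily ν ht,
    ← integral_sub (hi θ) (hi φ)]
  calc _ ≤ ∫ x, R * (2 * R * ‖θ - φ‖) * (density ν t θ x + density ν t φ x) ∂ν := by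
        refine norm_integral_le_of_norm_le (((hd θ).add (hd φ)).const_mul _)
          (.of_forall fun x => ?_)
        rw [← sub_smul, norm_smul, Real.norm_eq_abs]
        have h1 : |density ν t θ x - density ν t φ x|
            ≤ (2 * R * ‖θ - φ‖) * (density ν t θ x + density ν t φ x) := by
          refine (abs_exp_sub_exp_le _ _).trans
            (mul_le_mul_of_nonneg_right ?_ (add_pos (Real.exp_pos _) (Real.exp_pos _)).le)
          have e1 := abs_inner_le htR (θ - φ) x
          have e2 := abs_logPartition_sub_le hν ht htR θ φ
          have e3 : inner ℝ θ (t x) - logPartition ν t θ - (inner ℝ φ (t x) - logPartition ν t φ)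
            = inner ℝ (θ - φ) (t x) - (logPartition ν t θ - logPartition ν t φ) := by
            rw [inner_sub_left]; ring
          rw [e3]
          refine (abs_sub _ _).trans ?_
          linarith
        calc _ ≤ ((2 * R * ‖θ - φ‖) * (density ν t θ x + density ν t φ x)) * R :=
              mul_le_mul h1 (htR x) (norm_nonneg _) ((abs_nonneg _).trans h1)
          _ = _ := by ring
    _ = _ := by
        rw [integral_const_mul, integral_add (hd θ) (hd φ), integral_density hν ht htR,
          integral_density hν ht htR]
        ring

/-- A function squeezed between its tangent planes, with Lipschitz slopes, is differentiable. -/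
theorem hasGradientAt_of_lipschitz_subgradient {f : Param n → ℝ} {g : Param n → Param n} {c : ℝ}
    (hf : ∀ θ φ, f θ + inner ℝ (g θ) (φ - θ) ≤ f φ) (hg : ∀ θ φ, ‖g θ - g φ‖ ≤ c * ‖θ - φ‖)
    (θ : Param n) : HasGradientAt f (g θ) θ := by
  rw [hasGradientAt_iff_isLittleO]
  have h1 : (fun φ => f φ - f θ - inner ℝ (g θ) (φ - θ)) =O[nhds θ]
      fun φ => ‖φ - θ‖ ^ 2 := by
    refine Asymptotics.IsBigO.of_bound c (.of_forall fun φ => ?_)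
    -- The tangent plane at `θ` bounds the remainder below by 0; the one at `φ` bounds it above by
    -- `⟪g φ - g θ, φ - θ⟫`, which is quadratically small.
    have a := hf θ φ
    have b := hf φ θ
    have e : inner ℝ (g φ) (θ - φ) = - inner ℝ (g φ) (φ - θ) := by
      rw [← inner_neg_right, neg_sub]
    have d := real_inner_le_norm (g φ - g θ) (φ - θ)
    rw [inner_sub_left] at d
    have d2 := mul_le_mul_of_nonneg_right (hg φ θ) (norm_nonneg (φ - θ))
    rw [Real.norm_of_nonneg (by linarith), Real.norm_of_nonneg (by positivity)]
    nlinarith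
  refine h1.trans_isLittleO ?_
  have h2 : (fun φ : Param n => ‖φ - θ‖ ^ 2) =o[nhds θ] fun φ => ‖φ - θ‖ := by
    have h3 : Filter.Tendsto (fun φ : Param n => ‖φ - θ‖) (nhds θ) (nhds 0) := by
      have : Continuous fun φ : Param n => ‖φ - θ‖ := by fun_prop
      simpa using this.tendsto θ
    exact (Asymptotics.isLittleO_pow_id one_lt_two).comp_tendsto h3
  exact h2.of_norm_right

/-- The gradient of the regularized negative log-likelihood. -/
def gradLik (ν : Measure X) (t : X → Param n) (lam : ℝ) {D : ℕ} (z : Fin D → X)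
    (θ : Param n) : Param n :=
  meanStat ν t θ - empMean t z + lam • θ

theorem negLogLik_eq (ν : Measure X) (t : X → Param n) (lam : ℝ) {D : ℕ} (hD : 0 < D)
    (z : Fin D → X) (θ : Param n) :
    negLogLik ν t lam z θ
      = logPartition ν t θ - inner ℝ (empMean t z) θ + lam / 2 * ‖θ‖ ^ 2 := by
  have hD' : (D : ℝ) ≠ 0 := by positivity
  simp only [negLogLik, density, Real.log_exp, empMean, Finset.sum_sub_distrib, real_inner_smul_left,
    sum_inner, Finset.sum_const, Finset.card_univ, Fintype.card_fin, nsmul_eq_mul]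
  simp_rw [real_inner_comm θ]
  field_simp
  ring

theorem negLogLik_ge {ν : Measure X} [IsFiniteMeasure ν] (hν : ν ≠ 0)
    {t : X → Param n} (ht : Measurable t) {R : ℝ} (htR : ∀ x, ‖t x‖ ≤ R) {lam : ℝ}
    (hlam : 0 ≤ lam) {D : ℕ} (hD : 0 < D) (z : Fin D → X) (θ φ : Param n) :
    negLogLik ν t lam z θ + inner ℝ (gradLik ν t lam z θ) (φ - θ) ≤ negLogLik ν t lam z φ := by
  rw [negLogLik_eq ν t lam hD, negLogLik_eq ν t lam hD]
  have h1 := logPartition_ge hν ht htR θ φ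
  have h2 : ‖φ‖ ^ 2 = ‖θ‖ ^ 2 + 2 * inner ℝ θ (φ - θ) + ‖φ - θ‖ ^ 2 := by
    rw [← norm_add_sq_real, add_sub_cancel]
  simp only [gradLik, inner_add_left, inner_sub_left, real_inner_smul_left]
  have h3 : inner ℝ (empMean t z) φ = inner ℝ (empMean t z) θ + inner ℝ (empMean t z) (φ - θ) := by
    rw [← inner_add_right, add_sub_cancel]
  rw [h2, h3]
  nlinarith [mul_nonneg hlam (sq_nonneg ‖φ - θ‖)]

theorem norm_gradLik_sub_le {ν : Measure X} [IsFiniteMeasure ν] (hν : ν ≠ 0)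
    {t : X → Param n} (ht : Measurable t) {R : ℝ} (htR : ∀ x, ‖t x‖ ≤ R) {lam : ℝ}
    (hlam : 0 ≤ lam) {D : ℕ} (z : Fin D → X) (θ φ : Param n) :
    ‖gradLik ν t lam z θ - gradLik ν t lam z φ‖ ≤ (4 * R ^ 2 + lam) * ‖θ - φ‖ := by
  have e : gradLik ν t lam z θ - gradLik ν t lam z φ
      = (meanStat ν t θ - meanStat ν t φ) + lam • (θ - φ) := by
    simp only [gradLik, smul_sub]; abel
  rw [e, add_mul]
  refine (norm_add_le _ _).trans (add_le_add (norm_meanStat_sub_le hν ht htR θ φ) ?_)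
  rw [norm_smul, Real.norm_of_nonneg hlam]

theorem hasGradientAt_negLogLik {ν : Measure X} [IsFiniteMeasure ν] (hν : ν ≠ 0)
    {t : X → Param n} (ht : Measurable t) {R : ℝ} (htR : ∀ x, ‖t x‖ ≤ R) {lam : ℝ}
    (hlam : 0 ≤ lam) {D : ℕ} (hD : 0 < D) (z : Fin D → X) (θ : Param n) :
    HasGradientAt (negLogLik ν t lam z) (gradLik ν t lam z θ) θ :=
  hasGradientAt_of_lipschitz_subgradient (negLogLik_ge hν ht htR hlam hD z)
    (norm_gradLik_sub_le hν ht htR hlam z) θ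

theorem hasLipschitzGradient_negLogLik {ν : Measure X} [IsFiniteMeasure ν] (hν : ν ≠ 0)
    {t : X → Param n} (ht : Measurable t) {R : ℝ} (htR : ∀ x, ‖t x‖ ≤ R) {lam : ℝ}
    (hlam : 0 ≤ lam) {D : ℕ} (hD : 0 < D) (z : Fin D → X) :
    HasLipschitzGradient (negLogLik ν t lam z) (4 * R ^ 2 + lam) := by
  have h := hasGradientAt_negLogLik hν ht htR hlam hD z
  refine ⟨fun θ => (h θ).differentiableAt, fun θ φ => ?_⟩
  rw [(h θ).gradient, (h φ).gradient]
  exact norm_gradLik_sub_le hν ht htR hlam z θ φ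

end ExponentialFamily

/-! ### Projection and inexact projected gradient descent. -/

section ProjectedGradient

variable {n : ℕ}

/-- A nearest point must be shown to exist before `Classical.epsilon` says anything. The
obtuse-angle inequality is the form in which optimality is used afterwards. -/
theorem proj_spec {Θ : Set (Param n)} (hne : Θ.Nonempty) (hconv : Convex ℝ Θ)
    (hclosed : IsClosed Θ) (φ : Param n) :
    proj Θ φ ∈ Θ ∧ ∀ θ ∈ Θ, inner ℝ (φ - proj Θ φ) (θ - proj Θ φ) ≤ 0 := by
  have hbdd : BddBelow (Set.range fun w : Θ => ‖φ - w‖) :=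
    ⟨0, by rintro _ ⟨w, rfl⟩; exact norm_nonneg _⟩
  have hex : ∃ θ, θ ∈ Θ ∧ ∀ θ' ∈ Θ, ‖θ - φ‖ ≤ ‖θ' - φ‖ := by
    obtain ⟨w, hw, hmin⟩ := exists_norm_eq_iInf_of_complete_convex hne hclosed.isComplete hconv φ
    refine ⟨w, hw, fun θ' hθ' => ?_⟩
    rw [norm_sub_rev, hmin, norm_sub_rev θ']
    exact ciInf_le hbdd ⟨θ', hθ'⟩
  obtain ⟨hmem, hmin⟩ := Classical.epsilon_spec hex
  refine ⟨hmem, (norm_eq_iInf_iff_real_inner_le_zero hconv hmem).1 (le_antisymm ?_ ?_)⟩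
  · have : Nonempty Θ := hne.to_subtype
    refine le_ciInf fun w => ?_
    rw [norm_sub_rev, norm_sub_rev φ]
    exact hmin w w.2
  · exact ciInf_le hbdd ⟨_, hmem⟩

/-- Adding the two obtuse-angle inequalities shows that the projection is nonexpansive. Continuity
serves only to make the iterates measurable in the samples. -/
theorem continuous_proj {Θ : Set (Param n)} (hne : Θ.Nonempty) (hconv : Convex ℝ Θ)
    (hclosed : IsClosed Θ) : Continuous (proj Θ) := by
  refine (LipschitzWith.of_dist_le_mul (K := 1) fun φ ψ => ?_).continuous
  rw [dist_eq_norm, dist_eq_norm, NNReal.coe_one, one_mul]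
  obtain ⟨h1, h2⟩ := proj_spec hne hconv hclosed φ
  obtain ⟨h3, h4⟩ := proj_spec hne hconv hclosed ψ
  set a := proj Θ φ
  set b := proj Θ ψ
  have e1 := h2 b h3
  have e2 := h4 a h1
  have e3 : inner ℝ (φ - ψ) (a - b) - ‖a - b‖ ^ 2
      = - inner ℝ (φ - a) (b - a) - inner ℝ (ψ - b) (a - b) := by
    rw [← real_inner_self_eq_norm_sq, ← neg_sub a b, inner_neg_right, neg_neg, ← inner_sub_left,
      ← inner_sub_left]
    congr 1
    abel
  have e4 := real_inner_le_norm (φ - ψ) (a - b)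
  by_contra! h
  nlinarith [norm_nonneg (φ - ψ)]

/-- The quadratic upper bound for a function with Lipschitz gradient. -/
theorem HasLipschitzGradient.le_quadratic {f : Param n → ℝ} {L : ℝ} (hf : HasLipschitzGradient f L)
    (θ φ : Param n) :
    f φ ≤ f θ + inner ℝ (gradient f θ) (φ - θ) + L / 2 * ‖φ - θ‖ ^ 2 := by
  set h := φ - θ with hh
  -- The Lipschitz bound makes the derivative of `F` nonpositive on `(0, 1)`; comparing `F 1` with
  -- `F 0` is the claim.
  set F : ℝ → ℝ := fun s => f (θ + s • h) - s * inner ℝ (gradient f θ) h - L / 2 * ‖h‖ ^ 2 * s ^ 2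
  have hF (s : ℝ) : HasDerivAt F
      (inner ℝ (gradient f (θ + s • h)) h - inner ℝ (gradient f θ) h - L * ‖h‖ ^ 2 * s) s := by
    have hl : HasDerivAt (fun s : ℝ => θ + s • h) h s := by
      simpa using ((hasDerivAt_id s).smul_const h).const_add θ
    have h1 := (hf.1 (θ + s • h)).hasGradientAt.hasFDerivAt.comp_hasDerivAt s hl
    have h2 := (h1.sub ((hasDerivAt_id s).mul_const (inner ℝ (gradient f θ) h))).sub
      ((hasDerivAt_pow 2 s).const_mul (L / 2 * ‖h‖ ^ 2))
    refine h2.congr_deriv ?_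
    simp
    ring
  have hanti : AntitoneOn F (Set.Icc 0 1) := by
    refine antitoneOn_of_deriv_nonpos (convex_Icc 0 1)
      (fun s _ => (hF s).continuousAt.continuousWithinAt)
      (fun s _ => (hF s).differentiableAt.differentiableWithinAt) fun s hs => ?_
    rw [interior_Icc] at hs
    rw [(hF s).deriv]
    have h1 := real_inner_le_norm (gradient f (θ + s • h) - gradient f θ) h
    have h2 := hf.2 (θ + s • h) θ
    rw [add_sub_cancel_left, norm_smul, Real.norm_of_nonneg hs.1.le] at h2
    have h3 := mul_le_mul_of_nonneg_right h2 (norm_nonneg h)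
    rw [inner_sub_left] at h1
    nlinarith
  have := hanti (Set.left_mem_Icc.2 zero_le_one) (Set.right_mem_Icc.2 zero_le_one) zero_le_one
  have h1 : θ + (1 : ℝ) • h = φ := by rw [one_smul, hh, add_sub_cancel]
  simp only [F, h1, zero_smul, add_zero] at this
  linarith

/-- One step of the inexact projected gradient method. -/
theorem projected_step_bound {f : Param n → ℝ} {g : Param n → Param n} {L : ℝ} (hL : 0 < L)
    {Θ : Set (Param n)} (hconv : Convex ℝ Θ) (hclosed : IsClosed Θ)
    (hlow : ∀ θ φ, f θ + inner ℝ (g θ) (φ - θ) ≤ f φ)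
    (hup : ∀ θ φ, f φ ≤ f θ + inner ℝ (g θ) (φ - θ) + L / 2 * ‖φ - θ‖ ^ 2)
    {u : Param n} (hu : u ∈ Θ) (θ e : Param n) :
    f (proj Θ (θ - (1 / L) • (g θ + e))) - f u
        + L / 2 * ‖proj Θ (θ - (1 / L) • (g θ + e)) - u‖ ^ 2
      ≤ L / 2 * ‖θ - u‖ ^ 2 + ‖e‖ * ‖proj Θ (θ - (1 / L) • (g θ + e)) - u‖ := by
  obtain ⟨-, hp⟩ := proj_spec ⟨u, hu⟩ hconv hclosed (θ - (1 / L) • (g θ + e))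
  set w := proj Θ (θ - (1 / L) • (g θ + e))
  -- The quadratic bound at `w` and the tangent plane at `θ` bound `f w - f u` by an inner product
  -- of the gradient with `w - u`; the projection inequality trades it for `L⟪θ - w, w - u⟫`, and
  -- expanding `‖θ - u‖²` cancels the remaining squares.
  have h1 := hp u hu
  have h2 := hup θ w
  have h3 := hlow θ u
  have h4 : - inner ℝ e (w - u) ≤ ‖e‖ * ‖w - u‖ := by
    linarith [(abs_le.1 (abs_real_inner_le_norm e (w - u))).1]
  have e1 : θ - (1 / L) • (g θ + e) - w = (θ - w) - (1 / L) • (g θ + e) := by abel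
  have e2 : u - w = - (w - u) := by abel
  rw [e1, e2, inner_neg_right, inner_sub_left, real_inner_smul_left, inner_add_left] at h1
  have h5 : inner ℝ (g θ) (w - u) + inner ℝ e (w - u) ≤ L * inner ℝ (θ - w) (w - u) := by
    have c : (inner ℝ (g θ) (w - u) + inner ℝ e (w - u)) / L ≤ inner ℝ (θ - w) (w - u) := by
      rw [div_eq_inv_mul, ← one_div]
      linarith
    rw [div_le_iff₀ hL] at c
    linarith
  have h6 : ‖θ - u‖ ^ 2 = ‖θ - w‖ ^ 2 + 2 * inner ℝ (θ - w) (w - u) + ‖w - u‖ ^ 2 := by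
    rw [← norm_add_sq_real, sub_add_sub_cancel]
  have h7 : inner ℝ (g θ) (w - θ) = inner ℝ (g θ) (w - u) + inner ℝ (g θ) (u - θ) := by
    rw [← inner_add_right, sub_add_sub_cancel]
  have h8 : ‖w - θ‖ = ‖θ - w‖ := norm_sub_rev _ _
  rw [h8, h7] at h2
  rw [h6]
  linarith

/-- The recursion for the distance `d` to the minimizer and the accumulated gap `S`. -/
theorem potential_step {L d d' a ε Δ S : ℝ} (hL : 0 < L) (hd : 0 ≤ d) (hε : 0 ≤ ε)
    (hΔ : 0 ≤ Δ) (hs : Δ + L / 2 * d' ^ 2 ≤ L / 2 * d ^ 2 + ε * d') (hda : d ≤ a)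
    (hS : S + L / 2 * d ^ 2 ≤ L / 2 * a ^ 2) :
    d' ≤ a + 2 / L * ε ∧ S + Δ + L / 2 * d' ^ 2 ≤ L / 2 * (a + 2 / L * ε) ^ 2 := by
  obtain ⟨η, hη⟩ : ∃ η, η = 2 / L * ε := ⟨_, rfl⟩
  have hη0 : 0 ≤ η := by rw [hη]; positivity
  have hεη : ε = L / 2 * η := by rw [hη]; field_simp
  rw [← hη]
  rw [hεη, mul_assoc] at hs
  -- If `d' > d + η`, then `d'(d' - η) > (d + η)d ≥ d²`, against the quadratic inequality.
  have h1 : d' ≤ d + η := by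
    have h : d' ^ 2 ≤ d ^ 2 + η * d' :=
      le_of_mul_le_mul_left (a := L / 2) (by linarith) (by positivity)
    by_contra! hlt
    nlinarith
  have h2 : η * d' ≤ η * (a + η) := mul_le_mul_of_nonneg_left (by linarith) hη0
  have h3 : L / 2 * (η * d') ≤ L / 2 * (2 * a * η + η ^ 2) :=
    mul_le_mul_of_nonneg_left (by nlinarith) (by positivity)
  have h4 : L / 2 * (a + η) ^ 2 = L / 2 * a ^ 2 + L / 2 * (2 * a * η + η ^ 2) := by ring
  exact ⟨by linarith, by linarith⟩

/-- Convergence of the averaged iterates of the inexact projected gradient method. -/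
theorem inexact_projected_gradient {f : Param n → ℝ} {g : Param n → Param n} {L : ℝ} (hL : 0 < L)
    {Θ : Set (Param n)} (hconv : Convex ℝ Θ) (hclosed : IsClosed Θ)
    (hlow : ∀ θ φ, f θ + inner ℝ (g θ) (φ - θ) ≤ f φ)
    (hup : ∀ θ φ, f φ ≤ f θ + inner ℝ (g θ) (φ - θ) + L / 2 * ‖φ - θ‖ ^ 2)
    {u : Param n} (hu : u ∈ Θ) (hmin : ∀ θ ∈ Θ, f u ≤ f θ) {θ e : ℕ → Param n} {K : ℕ} (hK : 0 < K)
    (hstep : ∀ k < K, θ (k + 1) = proj Θ (θ k - (1 / L) • (g (θ k) + e k))) :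
    f ((1 / (K : ℝ)) • ∑ k ∈ Finset.Icc 1 K, θ k) - f u
      ≤ L / (2 * K) * (‖θ 0 - u‖ + 2 / L * ∑ k ∈ Finset.range K, ‖e k‖) ^ 2 := by
  have hinv : ∀ k ≤ K,
      ‖θ k - u‖ ≤ ‖θ 0 - u‖ + 2 / L * ∑ j ∈ Finset.range k, ‖e j‖ ∧
      ∑ j ∈ Finset.range k, (f (θ (j + 1)) - f u) + L / 2 * ‖θ k - u‖ ^ 2
        ≤ L / 2 * (‖θ 0 - u‖ + 2 / L * ∑ j ∈ Finset.range k, ‖e j‖) ^ 2 := by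
    intro k
    induction k with
    | zero => intro _; simp
    | succ k ih =>
      intro hk
      obtain ⟨ih1, ih2⟩ := ih (by omega)
      have hs := projected_step_bound hL hconv hclosed hlow hup hu (θ k) (e k)
      have hmem := (proj_spec ⟨u, hu⟩ hconv hclosed (θ k - (1 / L) • (g (θ k) + e k))).1
      rw [← hstep k (by omega)] at hs hmem
      have hf := hmin _ hmem
      rw [Finset.sum_range_succ, Finset.sum_range_succ]
      rw [mul_add, ← add_assoc]
      exact potential_step hL (norm_nonneg _) (norm_nonneg _) (sub_nonneg.2 hf)
        hs ih1 ih2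
  have hsum := (hinv K le_rfl).2
  set S := (‖θ 0 - u‖ + 2 / L * ∑ k ∈ Finset.range K, ‖e k‖) ^ 2
  have hK' : (0 : ℝ) < K := by exact_mod_cast hK
  set avg := (1 / (K : ℝ)) • ∑ k ∈ Finset.Icc 1 K, θ k with havg
  have hIcc : ∑ k ∈ Finset.Icc 1 K, θ k = ∑ k ∈ Finset.range K, θ (k + 1) := by
    rw [Finset.range_eq_Ico, Finset.sum_Ico_add' θ 0 K 1]; rfl
  -- Deviations from the average sum to zero, so summing the tangent planes at `avg` gives Jensen's
  -- inequality.
  have hz : ∑ k ∈ Finset.range K, (θ (k + 1) - avg) = 0 := by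
    rw [Finset.sum_sub_distrib, ← hIcc, Finset.sum_const, Finset.card_range, havg,
      ← Nat.cast_smul_eq_nsmul ℝ, smul_smul, mul_one_div_cancel hK'.ne', one_smul, sub_self]
  have hjensen : (K : ℝ) * f avg ≤ ∑ k ∈ Finset.range K, f (θ (k + 1)) := by
    calc (K : ℝ) * f avg
        = ∑ k ∈ Finset.range K, (f avg + inner ℝ (g avg) (θ (k + 1) - avg)) := by
          rw [Finset.sum_add_distrib, ← inner_sum, hz]; simp
      _ ≤ _ := Finset.sum_le_sum fun k _ => hlow _ _
  rw [Finset.sum_sub_distrib, Finset.sum_const, Finset.card_range, nsmul_eq_mul] at hsum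
  have h3 : 0 ≤ L / 2 * ‖θ K - u‖ ^ 2 := by positivity
  have h4 : L / (2 * K) * S = L / 2 * S / K := by field_simp
  rw [h4, le_div_iff₀ hK']
  nlinarith

end ProjectedGradient

/-! ### Differences of means in terms of total variation. -/

section TotalVariation

variable {n : ℕ} {X : Type*} [MeasurableSpace X]

theorem abs_sub_le_tvDist (p q : Measure X) [IsProbabilityMeasure p] [IsProbabilityMeasure q]
    {A : Set X} (hA : MeasurableSet A) : |p.real A - q.real A| ≤ tvDist p q := by
  refine le_ciSup (f := fun A : {A : Set X // MeasurableSet A} => |p.real A - q.real A|) ?_ ⟨A, hA⟩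
  refine ⟨1, ?_⟩
  rintro _ ⟨B, rfl⟩
  have h1 := measureReal_nonneg (μ := p) (s := (B : Set X))
  have h2 := measureReal_nonneg (μ := q) (s := (B : Set X))
  have h3 := measureReal_le_one (μ := p) (s := (B : Set X))
  have h4 := measureReal_le_one (μ := q) (s := (B : Set X))
  exact abs_le.2 ⟨by linarith, by linarith⟩

/-- Layer cake: each integral is the integral over levels in `(0, B]` of a tail probability, and at
every level the tails differ by at most the total variation distance. -/
theorem integral_sub_le_tvDist (p q : Measure X) [IsProbabilityMeasure p] [IsProbabilityMeasure q]
    {f : X → ℝ} (hf : Measurable f) {B : ℝ} (h0 : ∀ x, 0 ≤ f x) (hB : ∀ x, f x ≤ B)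
    (hB0 : 0 ≤ B) :
    ∫ x, f x ∂p - ∫ x, f x ∂q ≤ B * tvDist p q := by
  have hi (μ : Measure X) [IsProbabilityMeasure μ] : Integrable f μ :=
    .of_bound hf.aestronglyMeasurable B (.of_forall fun x => by
      rw [Real.norm_of_nonneg (h0 x)]; exact hB x)
  have hanti (μ : Measure X) [IsProbabilityMeasure μ] :
      IntegrableOn (fun s => μ.real {a | s ≤ f a}) (Set.Ioc 0 B) := by
    have ha : Antitone fun s => μ.real {a | s ≤ f a} := fun s s' hs =>
      measureReal_mono fun a (ha : s' ≤ f a) => hs.trans ha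
    exact .of_bound measure_Ioc_lt_top ha.measurable.aestronglyMeasurable 1
      (.of_forall fun s => by
        rw [Real.norm_of_nonneg measureReal_nonneg]; exact measureReal_le_one)
  rw [(hi p).integral_eq_integral_Ioc_meas_le (.of_forall h0) (.of_forall hB),
    (hi q).integral_eq_integral_Ioc_meas_le (.of_forall h0) (.of_forall hB),
    ← integral_sub (hanti p) (hanti q)]
  calc _ ≤ ∫ _ in Set.Ioc 0 B, tvDist p q :=
        integral_mono ((hanti p).sub (hanti q)) (integrable_const _) fun s =>
          (le_abs_self _).trans (abs_sub_le_tvDist p q (measurableSet_le measurable_const hf))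
    _ = B * tvDist p q := by simp [hB0]

/-- The difference `w` of the means is tested against itself: `⟪w, t x⟫ + ‖w‖R` takes values in `[0,
2R‖w‖]`, so the scalar bound applies and one factor `‖w‖` cancels. -/
theorem norm_integral_sub_le_tvDist (p q : Measure X) [IsProbabilityMeasure p]
    [IsProbabilityMeasure q] {t : X → Param n} (ht : Measurable t) {R : ℝ} (hR : 0 ≤ R)
    (htR : ∀ x, ‖t x‖ ≤ R) :
    ‖∫ x, t x ∂p - ∫ x, t x ∂q‖ ≤ 2 * R * tvDist p q := by
  set w := ∫ x, t x ∂p - ∫ x, t x ∂q with hw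
  have hb := abs_inner_le htR w
  have h := integral_sub_le_tvDist p q (f := fun x => inner ℝ w (t x) + ‖w‖ * R)
    ((measurable_inner_stat ht w).add_const _) (B := 2 * R * ‖w‖)
    (fun x => by linarith [(abs_le.1 (hb x)).1]) (fun x => by linarith [(abs_le.1 (hb x)).2])
    (by positivity)
  rw [integral_add (integrable_inner_stat ht htR w) (integrable_const _),
    integral_add (integrable_inner_stat ht htR w) (integrable_const _),
    integral_inner (integrable_of_norm_le ht htR), integral_inner (integrable_of_norm_le ht htR)]
    at h
  simp only [integral_const, probReal_univ, add_sub_add_right_eq_sub] at h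
  rw [← inner_sub_right, ← hw, real_inner_self_eq_norm_sq] at h
  rcases (norm_nonneg w).eq_or_lt with h0 | h0
  · rw [← h0]
    have := (abs_nonneg _).trans (abs_sub_le_tvDist p q MeasurableSet.univ)
    positivity
  · refine le_of_mul_le_mul_left ?_ h0
    nlinarith

end TotalVariation

/-! ### Concentration of the norm of a sum of independent vectors. -/

section Concentration

variable {n : ℕ} {X : Type*} [MeasurableSpace X]

theorem integrable_continuous_comp {Ω : Type*} [MeasurableSpace Ω] {μ : Measure Ω}
    [IsFiniteMeasure μ] {G : Param n → ℝ} (hG : Continuous G) {h : Ω → Param n}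
    (hm : Measurable h) {B : ℝ} (hB : ∀ ω, ‖h ω‖ ≤ B) : Integrable (fun ω => G (h ω)) μ := by
  obtain ⟨c, hc⟩ := (isCompact_closedBall (0 : Param n) B).exists_bound_of_continuousOn
    hG.continuousOn
  exact .of_bound (hG.measurable.comp hm).aestronglyMeasurable c
    (.of_forall fun ω => hc _ (by simpa using hB ω))

theorem norm_sum_comp_le {Y : Type*} {ξ : Y → Param n} {B : ℝ} (hB : ∀ a, ‖ξ a‖ ≤ B) {M : ℕ}
    (x : Fin M → Y) : ‖∑ i, ξ (x i)‖ ≤ M * B := by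
  simpa using norm_sum_le_of_le Finset.univ fun i _ => hB (x i)

theorem measurable_sum_comp {ξ : X → Param n} (hξ : Measurable ξ) (M : ℕ) :
    Measurable fun x : Fin M → X => ∑ i, ξ (x i) :=
  Finset.measurable_sum _ fun i _ => hξ.comp (measurable_pi_apply i)

/-- Fubini after splitting off the first sample. It drives the inductions on `M`, where the starting
vector stays free to absorb that sample. -/
theorem integral_pi_succ_sum (q : Measure X) [IsProbabilityMeasure q] {ξ : X → Param n}
    (hξ : Measurable ξ) {B : ℝ} (hB : ∀ a, ‖ξ a‖ ≤ B) {G : Param n → ℝ} (hG : Continuous G)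
    (M : ℕ) :
    ∫ x : Fin (M + 1) → X, G (∑ i, ξ (x i)) ∂(Measure.pi fun _ => q)
      = ∫ a, ∫ y : Fin M → X, G (ξ a + ∑ i, ξ (y i)) ∂(Measure.pi fun _ => q) ∂q := by
  have hmp := measurePreserving_piFinSuccAbove (fun _ : Fin (M + 1) => q) 0
  have h1 := hmp.integral_comp (MeasurableEquiv.measurableEmbedding _)
    (fun p : X × (Fin M → X) => G (ξ p.1 + ∑ i, ξ (p.2 i)))
  have hint : Integrable (fun p : X × (Fin M → X) => G (ξ p.1 + ∑ i, ξ (p.2 i)))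
      (q.prod (Measure.pi fun _ : Fin M => q)) :=
    integrable_continuous_comp hG
      ((hξ.comp measurable_fst).add ((measurable_sum_comp hξ M).comp measurable_snd))
      fun p => (norm_add_le _ _).trans (add_le_add (hB p.1) (norm_sum_comp_le hB p.2))
  rw [integral_prod _ hint] at h1
  rw [← h1]
  refine integral_congr_ae (.of_forall fun x => ?_)
  simp [Fin.sum_univ_succ, MeasurableEquiv.piFinSuccAbove, Fin.insertNthEquiv, Fin.tail]

/-- Second moment of a sum of independent centered vectors, started from `u`. -/
theorem integral_norm_add_sum_sq_le (q : Measure X) [IsProbabilityMeasure q] {ξ : X → Param n}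
    (hξ : Measurable ξ) {B : ℝ} (hB : ∀ a, ‖ξ a‖ ≤ B) (h0 : ∫ a, ξ a ∂q = 0) {V : ℝ}
    (hV : ∫ a, ‖ξ a‖ ^ 2 ∂q ≤ V) (M : ℕ) (u : Param n) :
    ∫ x : Fin M → X, ‖u + ∑ i, ξ (x i)‖ ^ 2 ∂(Measure.pi fun _ => q) ≤ ‖u‖ ^ 2 + M * V := by
  induction M generalizing u with
  | zero => simp
  | succ M ih =>
    rw [integral_pi_succ_sum q hξ hB (G := fun w => ‖u + w‖ ^ 2) (by fun_prop)]
    have hsq : Integrable (fun a => ‖ξ a‖ ^ 2) q :=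
      integrable_continuous_comp (G := fun w => ‖w‖ ^ 2) (by fun_prop) hξ hB
    have hin : Integrable (fun a => inner ℝ u (ξ a)) q := integrable_inner_stat hξ hB u
    have hint : Integrable (fun a => ‖u + ξ a‖ ^ 2) q :=
      integrable_continuous_comp (G := fun w => ‖u + w‖ ^ 2) (by fun_prop) hξ hB
    calc _ ≤ ∫ a, (‖u + ξ a‖ ^ 2 + M * V) ∂q := by
          refine integral_mono_of_nonneg (.of_forall fun a => integral_nonneg fun y => by positivity)
            (hint.add (integrable_const _)) (.of_forall fun a => ?_)
          simpa only [add_assoc] using ih (u + ξ a)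
      _ = ‖u‖ ^ 2 + ∫ a, ‖ξ a‖ ^ 2 ∂q + M * V := by
          rw [integral_add hint (integrable_const _)]
          simp_rw [norm_add_sq_real]
          rw [integral_add (f := fun a => ‖u‖ ^ 2 + 2 * inner ℝ u (ξ a))
              ((integrable_const _).add (hin.const_mul 2)) hsq,
            integral_add (integrable_const _) (hin.const_mul 2), integral_const_mul,
            integral_inner (integrable_of_norm_le hξ hB), h0]
          simp
      _ ≤ _ := by push_cast; linarith

theorem integral_norm_sub_mean_sq_le (q : Measure X) [IsProbabilityMeasure q] {t : X → Param n}
    (ht : Measurable t) {R : ℝ} (htR : ∀ x, ‖t x‖ ≤ R) :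
    ∫ a, ‖t a - ∫ x, t x ∂q‖ ^ 2 ∂q ≤ R ^ 2 := by
  set c := ∫ x, t x ∂q with hc
  have hsq : Integrable (fun a => ‖t a‖ ^ 2) q :=
    integrable_continuous_comp (G := fun w => ‖w‖ ^ 2) (by fun_prop) ht htR
  have hin := integrable_inner_stat (μ := q) ht htR c
  simp_rw [norm_sub_sq_real, real_inner_comm c]
  rw [integral_add (f := fun a => ‖t a‖ ^ 2 - 2 * inner ℝ c (t a))
    (hsq.sub (hin.const_mul 2)) (integrable_const _),
    integral_sub hsq (hin.const_mul 2), integral_const_mul,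
    integral_inner (integrable_of_norm_le ht htR), ← hc, real_inner_self_eq_norm_sq]
  have h : ∫ a, ‖t a‖ ^ 2 ∂q ≤ R ^ 2 := by
    calc _ ≤ ∫ _, R ^ 2 ∂q := integral_mono hsq (integrable_const _) fun a =>
          pow_le_pow_left₀ (norm_nonneg _) (htR a) 2
      _ = _ := by simp
  simp only [integral_const, probReal_univ, smul_eq_mul, one_mul]
  linarith [sq_nonneg ‖c‖]

/-- The expected norm of a sum of independent vectors, started from `u`. -/
def meanNormSum (q : Measure X) (ξ : X → Param n) (M : ℕ) (u : Param n) : ℝ :=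
  ∫ x : Fin M → X, ‖u + ∑ i, ξ (x i)‖ ∂(Measure.pi fun _ => q)

theorem integrable_norm_add_sum (q : Measure X) [IsProbabilityMeasure q] {ξ : X → Param n}
    (hξ : Measurable ξ) {B : ℝ} (hB : ∀ a, ‖ξ a‖ ≤ B) (M : ℕ) (u : Param n) :
    Integrable (fun x : Fin M → X => ‖u + ∑ i, ξ (x i)‖) (Measure.pi fun _ => q) :=
  integrable_continuous_comp (G := fun w => ‖u + w‖) (by fun_prop) (measurable_sum_comp hξ M)
    (norm_sum_comp_le hB)

/-- The bounded-difference input: displacing one summand moves the conditional expectation of the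
norm by no more than the displacement. -/
theorem meanNormSum_sub_le (q : Measure X) [IsProbabilityMeasure q] {ξ : X → Param n}
    (hξ : Measurable ξ) {B : ℝ} (hB : ∀ a, ‖ξ a‖ ≤ B) (M : ℕ) (u w : Param n) :
    meanNormSum q ξ M u - meanNormSum q ξ M w ≤ ‖u - w‖ := by
  rw [meanNormSum, meanNormSum, ← integral_sub (integrable_norm_add_sum q hξ hB M u)
    (integrable_norm_add_sum q hξ hB M w)]
  calc _ ≤ ∫ _ : Fin M → X, ‖u - w‖ ∂(Measure.pi fun _ => q) := by
        refine integral_mono ((integrable_norm_add_sum q hξ hB M u).sub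
          (integrable_norm_add_sum q hξ hB M w)) (integrable_const _) fun x => ?_
        refine (norm_sub_norm_le _ _).trans (le_of_eq ?_)
        congr 1
        abel
    _ = _ := by simp

theorem continuous_meanNormSum (q : Measure X) [IsProbabilityMeasure q] {ξ : X → Param n}
    (hξ : Measurable ξ) {B : ℝ} (hB : ∀ a, ‖ξ a‖ ≤ B) (M : ℕ) :
    Continuous (meanNormSum q ξ M) := by
  refine (LipschitzWith.of_dist_le_mul (K := 1) fun u w => ?_).continuous
  rw [Real.dist_eq, dist_eq_norm, NNReal.coe_one, one_mul, abs_sub_le_iff]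
  exact ⟨meanNormSum_sub_le q hξ hB M u w, norm_sub_rev u w ▸ meanNormSum_sub_le q hξ hB M w u⟩

/-- Sub-Gaussian concentration of the norm of a sum of independent bounded vectors. -/
theorem integral_exp_norm_add_sum_le (q : Measure X) [IsProbabilityMeasure q] {t : X → Param n}
    (ht : Measurable t) {R : ℝ} (hR : 0 ≤ R) (htR : ∀ x, ‖t x‖ ≤ R) (c : Param n) (s : ℝ) (M : ℕ)
    (u : Param n) :
    ∫ x : Fin M → X, Real.exp (s * ‖u + ∑ i, (t (x i) - c)‖) ∂(Measure.pi fun _ => q)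
      ≤ Real.exp (s * meanNormSum q (fun a => t a - c) M u + M * (R ^ 2 * s ^ 2 / 2)) := by
  have hξ : Measurable fun a => t a - c := ht.sub_const c
  have hB (a : X) : ‖t a - c‖ ≤ R + ‖c‖ := (norm_sub_le _ _).trans (by linarith [htR a])
  induction M generalizing u with
  | zero => simp [meanNormSum]
  | succ M ih =>
    rw [integral_pi_succ_sum q hξ hB (G := fun w => Real.exp (s * ‖u + w‖)) (by fun_prop)]
    -- `Φ a` is the conditional expectation of the norm given the first sample, the first step of
    -- the Doob martingale.
    set Φ : X → ℝ := fun a => meanNormSum q (fun a => t a - c) M (u + (t a - c)) with hΦ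
    have hcont := continuous_meanNormSum q hξ hB M
    have hΦm : Measurable Φ := hcont.measurable.comp (hξ.const_add u)
    have hmean : ∫ a, Φ a ∂q = meanNormSum q (fun a => t a - c) (M + 1) u := by
      rw [meanNormSum, integral_pi_succ_sum q hξ hB (G := fun w => ‖u + w‖) (by fun_prop)]
      simp only [hΦ, meanNormSum, add_assoc]
    -- Comparing with the start `u - c`, at distance `‖t a‖ ≤ R`, confines `Φ` to an interval of
    -- length `2R` whatever `c` is; Hoeffding's lemma then has variance proxy `R²`.
    have hmem (a : X) : Φ a ∈ Set.Icc (meanNormSum q (fun a => t a - c) M (u - c) - R)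
        (meanNormSum q (fun a => t a - c) M (u - c) + R) := by
      have h1 := meanNormSum_sub_le q hξ hB M (u + (t a - c)) (u - c)
      have h2 := meanNormSum_sub_le q hξ hB M (u - c) (u + (t a - c))
      have e : u + (t a - c) - (u - c) = t a := by abel
      rw [norm_sub_rev, e] at h2
      rw [e] at h1
      have := htR a
      constructor <;> simp only [hΦ] <;> linarith
    have hoeff := (hasSubgaussianMGF_of_mem_Icc (μ := q) hΦm.aemeasurable (.of_forall hmem)).mgf_le s
    have hconst : ((((‖meanNormSum q (fun a => t a - c) M (u - c) + R
        - (meanNormSum q (fun a => t a - c) M (u - c) - R)‖₊ / 2) ^ 2 : NNReal)) : ℝ) = R ^ 2 := by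
      rw [add_sub_sub_cancel]
      push_cast
      rw [Real.norm_of_nonneg (by positivity)]
      ring
    rw [hconst, hmean, mgf] at hoeff
    set m := meanNormSum q (fun a => t a - c) (M + 1) u
    have hint : Integrable (fun a => Real.exp (s * Φ a + M * (R ^ 2 * s ^ 2 / 2))) q :=
      integrable_continuous_comp (h := fun a => t a - c)
        (G := fun w => Real.exp (s * meanNormSum q (fun a => t a - c) M (u + w)
          + M * (R ^ 2 * s ^ 2 / 2))) (by fun_prop) hξ hB
    calc _ ≤ ∫ a, Real.exp (s * Φ a + M * (R ^ 2 * s ^ 2 / 2)) ∂q := by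
          refine integral_mono_of_nonneg
            (.of_forall fun a => integral_nonneg fun y => (Real.exp_pos _).le) hint
            (.of_forall fun a => ?_)
          simpa only [add_assoc] using ih (u + (t a - c))
      _ = Real.exp (s * m + M * (R ^ 2 * s ^ 2 / 2)) * ∫ a, Real.exp (s * (Φ a - m)) ∂q := by
          rw [← integral_const_mul]
          refine integral_congr_ae (.of_forall fun a => ?_)
          simp only [← Real.exp_add]
          congr 1
          ring
      _ ≤ Real.exp (s * m + M * (R ^ 2 * s ^ 2 / 2)) * Real.exp (R ^ 2 * s ^ 2 / 2) :=
          mul_le_mul_of_nonneg_left hoeff (Real.exp_pos _).le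
      _ = _ := by
          rw [← Real.exp_add]
          congr 1
          push_cast
          ring

theorem meanNormSum_zero_le (q : Measure X) [IsProbabilityMeasure q] {t : X → Param n}
    (ht : Measurable t) {R : ℝ} (hR : 0 < R) (htR : ∀ x, ‖t x‖ ≤ R) {M : ℕ} (hM : 0 < M) :
    meanNormSum q (fun a => t a - ∫ x, t x ∂q) M 0 ≤ R * √M := by
  set c := ∫ x, t x ∂q with hc
  have hξ : Measurable fun a => t a - c := ht.sub_const c
  have hB (a : X) : ‖t a - c‖ ≤ R + ‖c‖ := (norm_sub_le _ _).trans (by linarith [htR a])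
  have h0 : ∫ a, (t a - c) ∂q = 0 := by
    rw [integral_sub (integrable_of_norm_le ht htR) (integrable_const _)]
    simp [hc]
  have h2 := integral_norm_add_sum_sq_le q hξ hB h0 (integral_norm_sub_mean_sq_le q ht htR) M 0
  have hsq : Integrable (fun x : Fin M → X => ‖0 + ∑ i, (t (x i) - c)‖ ^ 2)
      (Measure.pi fun _ => q) :=
    integrable_continuous_comp (G := fun w => ‖0 + w‖ ^ 2) (by fun_prop)
      (measurable_sum_comp hξ M) (norm_sum_comp_le hB)
  have hM' : (0 : ℝ) < M := by exact_mod_cast hM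
  have hs : 0 < √(M : ℝ) := Real.sqrt_pos.2 hM'
  set b := R * √M with hb
  have hb0 : 0 < b := by positivity
  have hb2 : b ^ 2 = M * R ^ 2 := by rw [hb, mul_pow, Real.sq_sqrt hM'.le]; ring
  -- The inequality `y ≤ (y² + b²)/(2b)` with `b = R√M` plays the role of Cauchy–Schwarz.
  calc _ ≤ ∫ x : Fin M → X, ((‖0 + ∑ i, (t (x i) - c)‖ ^ 2 + b ^ 2) / (2 * b))
          ∂(Measure.pi fun _ => q) := by
        refine integral_mono (integrable_norm_add_sum q hξ hB M 0)
          ((hsq.add (integrable_const _)).div_const _) fun x => ?_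
        simp only
        rw [le_div_iff₀ (by positivity)]
        nlinarith [sq_nonneg (‖0 + ∑ i, (t (x i) - c)‖ - b)]
    _ = ((∫ x : Fin M → X, ‖0 + ∑ i, (t (x i) - c)‖ ^ 2 ∂(Measure.pi fun _ => q)) + b ^ 2)
          / (2 * b) := by
        rw [integral_div, integral_add hsq (integrable_const _)]
        simp
    _ ≤ (b ^ 2 + b ^ 2) / (2 * b) := by
        gcongr
        rw [hb2]
        simpa using h2
    _ = b := by field_simp; ring

/-- Exponential moment of the deviation of an empirical mean. -/
theorem integral_exp_norm_mean_sub_le (q : Measure X) [IsProbabilityMeasure q] {t : X → Param n}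
    (ht : Measurable t) {R : ℝ} (hR : 0 < R) (htR : ∀ x, ‖t x‖ ≤ R) {M : ℕ} (hM : 0 < M) :
    ∫ x : Fin M → X, Real.exp (R⁻¹ * ‖(1 / (M : ℝ)) • ∑ i, t (x i) - ∫ y, t y ∂q‖)
        ∂(Measure.pi fun _ => q)
      ≤ Real.exp (1 / √M + 1 / (2 * M)) := by
  have hM' : (0 : ℝ) < M := by exact_mod_cast hM
  have hs : 0 < √(M : ℝ) := Real.sqrt_pos.2 hM'
  -- The parameter `1/(MR)` is scale `1/R` for the mean instead of the sum; the sub-Gaussian term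
  -- becomes `1/(2M)`.
  have h := integral_exp_norm_add_sum_le q ht hR.le htR (∫ y, t y ∂q) (1 / (M * R)) M 0
  have e (x : Fin M → X) : R⁻¹ * ‖(1 / (M : ℝ)) • ∑ i, t (x i) - ∫ y, t y ∂q‖
      = 1 / (M * R) * ‖0 + ∑ i, (t (x i) - ∫ y, t y ∂q)‖ := by
    have : (1 / (M : ℝ)) • ∑ i, t (x i) - ∫ y, t y ∂q
        = (1 / (M : ℝ)) • (0 + ∑ i, (t (x i) - ∫ y, t y ∂q)) := by
      rw [zero_add, Finset.sum_sub_distrib, smul_sub, Finset.sum_const, Finset.card_univ,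
        Fintype.card_fin, ← Nat.cast_smul_eq_nsmul ℝ, smul_smul, one_div_mul_cancel hM'.ne',
        one_smul]
    rw [this, norm_smul, Real.norm_of_nonneg (by positivity)]
    field_simp
  simp_rw [e]
  refine h.trans (Real.exp_le_exp.2 (add_le_add ?_ ?_))
  · calc _ ≤ 1 / (M * R) * (R * √M) :=
          mul_le_mul_of_nonneg_left (meanNormSum_zero_le q ht hR htR hM) (by positivity)
      _ = 1 / √M := by
          field_simp
          rw [Real.sq_sqrt hM'.le]
  · apply le_of_eq
    field_simp

end Concentration

/-! ### Measurability and the tower property for the adaptive samples. -/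

section SamplesLaw

variable {n : ℕ} {X : Type*} [MeasurableSpace X]

theorem isProbabilityMeasure_bind_of_measurable {α β : Type*} [MeasurableSpace α]
    [MeasurableSpace β] {m : Measure α} [IsProbabilityMeasure m] {κ : α → Measure β}
    (hκ : Measurable κ) (hp : ∀ a, IsProbabilityMeasure (κ a)) :
    IsProbabilityMeasure (m.bind κ) := by
  constructor
  rw [Measure.bind_apply MeasurableSet.univ hκ.aemeasurable]
  simp

theorem chainLaw_succ (T : Kernel X X) (v : ℕ) (q : Measure X) :
    chainLaw T (v + 1) q = (chainLaw T v q).bind T :=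
  Function.iterate_succ_apply' _ _ _

theorem isProbabilityMeasure_chainLaw (T : Kernel X X) [IsMarkovKernel T] (v : ℕ) (q : Measure X)
    [IsProbabilityMeasure q] : IsProbabilityMeasure (chainLaw T v q) := by
  induction v with
  | zero => simpa [chainLaw]
  | succ v ih =>
    rw [chainLaw_succ]
    exact isProbabilityMeasure_bind_of_measurable T.measurable inferInstance

theorem measurable_chainLaw {T : Param n → Kernel X X} (hT : ∀ θ, IsMarkovKernel (T θ))
    (hTm : Measurable fun p : Param n × X => T p.1 p.2) (v : ℕ) (r : Measure X)
    [IsProbabilityMeasure r] : Measurable fun θ => chainLaw (T θ) v r := by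
  induction v with
  | zero => exact measurable_const
  | succ v ih =>
    refine Measure.measurable_of_measurable_coe _ fun s hs => ?_
    simp_rw [chainLaw_succ, Measure.bind_apply hs (Kernel.measurable _).aemeasurable]
    let κ : Kernel (Param n) X := ⟨fun θ => chainLaw (T θ) v r, ih⟩
    have : IsMarkovKernel κ := ⟨fun θ => isProbabilityMeasure_chainLaw (T θ) v r⟩
    exact Measurable.lintegral_kernel_prod_right' (κ := κ)
      (f := fun p : Param n × X => T p.1 p.2 s) ((Measure.measurable_coe hs).comp hTm)

theorem measurable_pi_const {α : Type*} [MeasurableSpace α] {Q : α → Measure X}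
    (hQ : Measurable Q) (hp : ∀ a, IsProbabilityMeasure (Q a)) (M : ℕ) :
    Measurable fun a => Measure.pi fun _ : Fin M => Q a := by
  refine Measurable.measure_of_isPiSystem_of_isProbabilityMeasure generateFrom_pi.symm
    isPiSystem_pi ?_
  rintro _ ⟨s, hs, rfl⟩
  simp_rw [Measure.pi_pi]
  exact Finset.measurable_prod _ fun i _ =>
    (Measure.measurable_coe (hs i (Set.mem_univ i))).comp hQ

theorem measurable_snoc (Y : Type*) [MeasurableSpace Y] (k : ℕ) :
    Measurable fun p : (Fin k → Y) × Y => Fin.snoc (α := fun _ => Y) p.1 p.2 := by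
  refine measurable_pi_iff.2 fun i => ?_
  induction i using Fin.lastCases with
  | last => simpa using measurable_snd
  | cast j =>
    simp only [Fin.snoc_castSucc]
    exact (measurable_pi_apply j).comp measurable_fst

theorem measurable_snoc_right {Y : Type*} [MeasurableSpace Y] {k : ℕ} (h : Fin k → Y) :
    Measurable fun y : Y => Fin.snoc (α := fun _ => Y) h y :=
  (measurable_snoc Y k).comp measurable_prodMk_left

section Iter

variable {K M : ℕ} {step : Param n → (Fin M → X) → Param n} {θ₀ : Param n}

theorem measurable_iter
    (hstep : Measurable fun p : Param n × (Fin M → X) => step p.1 p.2) (k : ℕ) :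
    Measurable fun h : Fin K → Fin M → X => iter step θ₀ h k := by
  induction k with
  | zero => exact measurable_const
  | succ k ih =>
    by_cases hk : k < K
    · simp only [iter, hk, dite_true]
      exact hstep.comp (ih.prodMk (measurable_pi_apply _))
    · simpa only [iter, hk, dite_false] using ih

/-- Adaptedness: iterate `j` reads only the batches with index below `j`, so a batch appended at
index `k ≥ j` cannot change it. -/
theorem iter_snoc {Y : Type*} {step : Param n → (Fin M → Y) → Param n} {k : ℕ}
    (h : Fin k → Fin M → Y) (x : Fin M → Y) {j : ℕ} (hj : j ≤ k) :
    iter step θ₀ (Fin.snoc (α := fun _ => Fin M → Y) h x) j = iter step θ₀ h j := by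
  induction j with
  | zero => rfl
  | succ j ih =>
    have h1 : j < k + 1 := by omega
    have h2 : j < k := by omega
    simp only [iter, h1, h2, dite_true]
    rw [ih (by omega)]
    congr 1
    exact Fin.snoc_castSucc (α := fun _ => Fin M → Y) x h ⟨j, h2⟩

theorem measurable_batch_law
    (hstep : Measurable fun p : Param n × (Fin M → X) => step p.1 p.2) {Q : Param n → Measure X}
    (hQ : Measurable Q) (hp : ∀ θ, IsProbabilityMeasure (Q θ)) (k : ℕ) :
    Measurable fun h : Fin k → Fin M → X =>
      (Measure.pi fun _ : Fin M => Q (iter step θ₀ h k)).map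
        fun x => Fin.snoc (α := fun _ => Fin M → X) h x := by
  refine Measure.measurable_of_measurable_coe _ fun s hs => ?_
  let κ : Kernel (Fin k → Fin M → X) (Fin M → X) :=
    ⟨fun h => Measure.pi fun _ : Fin M => Q (iter step θ₀ h k),
      (measurable_pi_const hQ hp M).comp (measurable_iter hstep k)⟩
  have : IsMarkovKernel κ := ⟨fun h => by simp only [κ, Kernel.coe_mk]; infer_instance⟩
  have hm := Kernel.measurable_kernel_prodMk_left (κ := κ) (measurable_snoc (Fin M → X) k hs)
  simp_rw [Measure.map_apply (measurable_snoc_right _) hs]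
  exact hm

theorem isProbabilityMeasure_samplesLaw
    (hstep : Measurable fun p : Param n × (Fin M → X) => step p.1 p.2) {Q : Param n → Measure X}
    (hQ : Measurable Q) (hp : ∀ θ, IsProbabilityMeasure (Q θ)) (k : ℕ) :
    IsProbabilityMeasure (samplesLaw step θ₀ Q k) := by
  induction k with
  | zero => rw [samplesLaw]; infer_instance
  | succ k ih =>
    rw [samplesLaw]
    exact isProbabilityMeasure_bind_of_measurable (measurable_batch_law hstep hQ hp k) fun h =>
      Measure.isProbabilityMeasure_map (measurable_snoc_right h).aemeasurable

/-- The tower property: integrate over the newest batch given the past, then over the past. -/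
theorem lintegral_samplesLaw_succ
    (hstep : Measurable fun p : Param n × (Fin M → X) => step p.1 p.2) {Q : Param n → Measure X}
    (hQ : Measurable Q) (hp : ∀ θ, IsProbabilityMeasure (Q θ)) (k : ℕ)
    {F : (Fin (k + 1) → Fin M → X) → ENNReal} (hF : Measurable F) :
    ∫⁻ h, F h ∂(samplesLaw step θ₀ Q (k + 1))
      = ∫⁻ h, ∫⁻ x, F (Fin.snoc (α := fun _ => Fin M → X) h x)
          ∂(Measure.pi fun _ : Fin M => Q (iter step θ₀ h k)) ∂(samplesLaw step θ₀ Q k) := by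
  rw [samplesLaw, Measure.lintegral_bind (measurable_batch_law hstep hQ hp k).aemeasurable
    hF.aemeasurable]
  refine lintegral_congr fun h => ?_
  rw [lintegral_map hF (measurable_snoc_right h)]

theorem measurable_batch_prod
    (hstep : Measurable fun p : Param n × (Fin M → X) => step p.1 p.2)
    {W : Param n → (Fin M → X) → ENNReal}
    (hW : Measurable fun p : Param n × (Fin M → X) => W p.1 p.2) (k : ℕ) :
    Measurable fun h : Fin k → Fin M → X => ∏ j : Fin k, W (iter step θ₀ h j) (h j) :=
  Finset.measurable_prod _ fun j _ =>
    hW.comp ((measurable_iter hstep j).prodMk (measurable_pi_apply j))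

/-- If the conditional mean of each factor given the past is at most `B`, the mean of the product
of `k` factors is at most `B ^ k`. -/
theorem lintegral_batch_prod_le
    (hstep : Measurable fun p : Param n × (Fin M → X) => step p.1 p.2) {Q : Param n → Measure X}
    (hQ : Measurable Q) (hp : ∀ θ, IsProbabilityMeasure (Q θ))
    {W : Param n → (Fin M → X) → ENNReal}
    (hW : Measurable fun p : Param n × (Fin M → X) => W p.1 p.2) {B : ENNReal}
    (hB : ∀ θ, ∫⁻ x, W θ x ∂(Measure.pi fun _ : Fin M => Q θ) ≤ B) (k : ℕ) :
    ∫⁻ h, ∏ j : Fin k, W (iter step θ₀ h j) (h j) ∂(samplesLaw step θ₀ Q k) ≤ B ^ k := by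
  induction k with
  | zero =>
    have := isProbabilityMeasure_samplesLaw (θ₀ := θ₀) hstep hQ hp 0
    simp
  | succ k ih =>
    rw [lintegral_samplesLaw_succ hstep hQ hp k (measurable_batch_prod hstep hW (k + 1))]
    have e (h : Fin k → Fin M → X) (x : Fin M → X) :
        ∏ j : Fin (k + 1), W (iter step θ₀ (Fin.snoc (α := fun _ => Fin M → X) h x) j)
            (Fin.snoc (α := fun _ => Fin M → X) h x j)
          = (∏ j : Fin k, W (iter step θ₀ h j) (h j)) * W (iter step θ₀ h k) x := by
      rw [Fin.prod_univ_castSucc]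
      congr 1
      · refine Finset.prod_congr rfl fun j _ => ?_
        rw [Fin.snoc_castSucc, Fin.val_castSucc, iter_snoc h x j.2.le]
      · rw [Fin.snoc_last, Fin.val_last, iter_snoc h x le_rfl]
    simp_rw [e]
    calc _ ≤ ∫⁻ h, (∏ j : Fin k, W (iter step θ₀ h j) (h j)) * B ∂(samplesLaw step θ₀ Q k) := by
          refine lintegral_mono fun h => ?_
          rw [lintegral_const_mul _ (f := fun x => W (iter step θ₀ h k) x)
            (hW.comp measurable_prodMk_left)]
          gcongr
          exact hB _
      _ ≤ _ := by
          rw [lintegral_mul_const _ (measurable_batch_prod hstep hW k), pow_succ]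
          gcongr

end Iter

theorem measurable_integral_stat {Q : Param n → Measure X} (hQ : Measurable Q)
    (hp : ∀ θ, IsProbabilityMeasure (Q θ)) {t : X → Param n} (ht : Measurable t) :
    Measurable fun θ => ∫ x, t x ∂(Q θ) := by
  let κ : Kernel (Param n) X := ⟨Q, hQ⟩
  have : IsMarkovKernel κ := ⟨hp⟩
  exact (StronglyMeasurable.integral_kernel (κ := κ) ht.stronglyMeasurable).measurable

theorem measurable_pgdStep {Θ : Set (Param n)} (hne : Θ.Nonempty) (hconv : Convex ℝ Θ)
    (hclosed : IsClosed Θ) {t : X → Param n} (ht : Measurable t) (tbar : Param n) (lam L : ℝ)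
    (M : ℕ) :
    Measurable fun p : Param n × (Fin M → X) => pgdStep t tbar lam L Θ p.1 p.2 := by
  refine (continuous_proj hne hconv hclosed).measurable.comp ?_
  have h : Measurable fun p : Param n × (Fin M → X) => ∑ i, t (p.2 i) :=
    (measurable_sum_comp ht M).comp measurable_snd
  fun_prop

end SamplesLaw

/-! ### High-probability bound on the total sampling error. -/

section SamplingError

variable {n : ℕ} {X : Type*} [MeasurableSpace X]

theorem measurable_batch_sum {M : ℕ} {step : Param n → (Fin M → X) → Param n} {θ₀ : Param n}
    (hstep : Measurable fun p : Param n × (Fin M → X) => step p.1 p.2)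
    {Y : Param n → (Fin M → X) → ℝ}
    (hY : Measurable fun p : Param n × (Fin M → X) => Y p.1 p.2) (k : ℕ) :
    Measurable fun h : Fin k → Fin M → X => ∑ j : Fin k, Y (iter step θ₀ h j) (h j) :=
  Finset.measurable_sum _ fun j _ =>
    hY.comp ((measurable_iter hstep j).prodMk (measurable_pi_apply j))

/-- The sampling error of a batch. -/
def batchError (Q : Param n → Measure X) (t : X → Param n) {M : ℕ} (θ : Param n)
    (x : Fin M → X) : ℝ :=
  ‖(1 / (M : ℝ)) • ∑ i, t (x i) - ∫ y, t y ∂(Q θ)‖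

theorem measurable_batchError {Q : Param n → Measure X} (hQ : Measurable Q)
    (hp : ∀ θ, IsProbabilityMeasure (Q θ)) {t : X → Param n} (ht : Measurable t) (M : ℕ) :
    Measurable fun p : Param n × (Fin M → X) => batchError Q t p.1 p.2 := by
  have h1 : Measurable fun p : Param n × (Fin M → X) => ∑ i, t (p.2 i) :=
    (measurable_sum_comp ht M).comp measurable_snd
  have h2 : Measurable fun p : Param n × (Fin M → X) => ∫ y, t y ∂(Q p.1) :=
    (measurable_integral_stat hQ hp ht).comp measurable_fst
  exact ((h1.const_smul (1 / (M : ℝ))).sub h2).norm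

theorem lintegral_exp_batchError_le {Q : Param n → Measure X}
    (hp : ∀ θ, IsProbabilityMeasure (Q θ)) {t : X → Param n} (ht : Measurable t) {R : ℝ}
    (hR : 0 < R) (htR : ∀ x, ‖t x‖ ≤ R) {M : ℕ} (hM : 0 < M) (θ : Param n) :
    ∫⁻ x : Fin M → X, ENNReal.ofReal (Real.exp (R⁻¹ * batchError Q t θ x))
        ∂(Measure.pi fun _ => Q θ)
      ≤ ENNReal.ofReal (Real.exp (1 / √M + 1 / (2 * M))) := by
  have hint : Integrable (fun x : Fin M → X => Real.exp (R⁻¹ * batchError Q t θ x))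
      (Measure.pi fun _ => Q θ) :=
    integrable_continuous_comp
      (G := fun w => Real.exp (R⁻¹ * ‖(1 / (M : ℝ)) • w - ∫ y, t y ∂(Q θ)‖)) (by fun_prop)
      (measurable_sum_comp ht M) (norm_sum_comp_le htR)
  rw [← ofReal_integral_eq_lintegral_ofReal hint (.of_forall fun x => (Real.exp_pos _).le)]
  exact ENNReal.ofReal_le_ofReal (integral_exp_norm_mean_sub_le (Q θ) ht hR htR hM)

/-- Chernoff bound for a product of exponentials. -/
theorem one_sub_le_measureReal_of_lintegral_exp_le {Ω : Type*} [MeasurableSpace Ω]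
    {μ : Measure Ω} [IsProbabilityMeasure μ] {S : Ω → ℝ} (hS : Measurable S) {R c δ : ℝ}
    (hR : 0 < R) (hδ : 0 < δ)
    (hexp : ∫⁻ ω, ENNReal.ofReal (Real.exp (R⁻¹ * S ω)) ∂μ
      ≤ ENNReal.ofReal (Real.exp (c - Real.log (1 / δ)))) :
    1 - δ ≤ μ.real {ω | S ω ≤ R * c} := by
  have hm : Measurable fun ω => ENNReal.ofReal (Real.exp (R⁻¹ * S ω)) :=
    (hS.const_mul _).exp.ennreal_ofReal
  -- Markov's inequality gives `exp c` times the probability of `bad` at most `exp c * δ`.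
  set bad := {ω | ENNReal.ofReal (Real.exp c) ≤ ENNReal.ofReal (Real.exp (R⁻¹ * S ω))} with hbad
  have hbadm : MeasurableSet bad := measurableSet_le measurable_const hm
  have hbadle : μ.real bad ≤ δ := by
    have h1 := ENNReal.toReal_mono ENNReal.ofReal_ne_top
      ((mul_meas_ge_le_lintegral hm (ENNReal.ofReal (Real.exp c))).trans hexp)
    rw [ENNReal.toReal_mul, ENNReal.toReal_ofReal (Real.exp_pos _).le,
      ENNReal.toReal_ofReal (Real.exp_pos _).le, sub_eq_add_neg, Real.exp_add, one_div,
      Real.log_inv, neg_neg, Real.exp_log hδ] at h1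
    exact le_of_mul_le_mul_left h1 (Real.exp_pos _)
  calc 1 - δ ≤ μ.real badᶜ := by rw [probReal_compl_eq_one_sub hbadm]; linarith
    _ ≤ _ := by
      refine measureReal_mono fun ω hω => ?_
      simp only [hbad, Set.mem_compl_iff, Set.mem_ofPred_eq, not_le] at hω
      have h1 := Real.exp_lt_exp.1 ((ENNReal.ofReal_lt_ofReal_iff (Real.exp_pos _)).1 hω)
      rw [inv_mul_lt_iff₀ hR] at h1
      exact h1.le

/-- With probability at least `1 - δ`, the sampling errors of all batches add up to at most
`2 R (K / √M + log (1 / δ))`. -/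
theorem samplesLaw_sum_error_le {M : ℕ} {step : Param n → (Fin M → X) → Param n} {θ₀ : Param n}
    (hstep : Measurable fun p : Param n × (Fin M → X) => step p.1 p.2) {Q : Param n → Measure X}
    (hQ : Measurable Q) (hp : ∀ θ, IsProbabilityMeasure (Q θ)) {t : X → Param n}
    (ht : Measurable t) {R : ℝ} (hR : 0 < R) (htR : ∀ x, ‖t x‖ ≤ R) {K : ℕ} (hK : 0 < K) {δ : ℝ}
    (hδ0 : 0 < δ) (hδ1 : δ < 1) (hM : 3 * (K : ℝ) / Real.log (1 / δ) ≤ M) :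
    1 - δ ≤ (samplesLaw step θ₀ Q K).real
      {h | ∑ j : Fin K, batchError Q t (iter step θ₀ h j) (h j)
        ≤ R * (2 * (K / √M + Real.log (1 / δ)))} := by
  have hK' : (0 : ℝ) < K := by exact_mod_cast hK
  have hℓ : 0 < Real.log (1 / δ) := Real.log_pos (by rw [lt_div_iff₀ hδ0]; linarith)
  have hM' : (0 : ℝ) < M := lt_of_lt_of_le (by positivity) hM
  have hs : 0 < √(M : ℝ) := Real.sqrt_pos.2 hM'
  have hμ := isProbabilityMeasure_samplesLaw (θ₀ := θ₀) hstep hQ hp K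
  have hYm := measurable_batchError hQ hp ht M
  have hSm : Measurable fun h : Fin K → Fin M → X =>
      ∑ j : Fin K, batchError Q t (iter step θ₀ h j) (h j) :=
    measurable_batch_sum hstep hYm K
  refine one_sub_le_measureReal_of_lintegral_exp_le hSm hR hδ0 ?_
  have hmoment := lintegral_batch_prod_le (θ₀ := θ₀) hstep hQ hp
    (W := fun θ x => ENNReal.ofReal (Real.exp (R⁻¹ * batchError Q t θ x)))
    (hYm.const_mul R⁻¹).exp.ennreal_ofReal
    (lintegral_exp_batchError_le hp ht hR htR (by exact_mod_cast hM')) K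
  have hprod (h : Fin K → Fin M → X) :
      ∏ j : Fin K, ENNReal.ofReal (Real.exp (R⁻¹ * batchError Q t (iter step θ₀ h j) (h j)))
        = ENNReal.ofReal
          (Real.exp (R⁻¹ * ∑ j : Fin K, batchError Q t (iter step θ₀ h j) (h j))) := by
    rw [Finset.mul_sum, Real.exp_sum,
      ENNReal.ofReal_prod_of_nonneg fun _ _ => (Real.exp_pos _).le]
  simp_rw [hprod] at hmoment
  refine hmoment.trans ?_
  rw [← ENNReal.ofReal_pow (Real.exp_pos _).le, ← Real.exp_nat_mul]
  refine ENNReal.ofReal_le_ofReal (Real.exp_le_exp.2 ?_)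
  -- The batch size serves to absorb the total sub-Gaussian term `K/(2M)` into one `log (1/δ)`; the
  -- other copy of the logarithm in the threshold pays for `δ`.
  have h1 : 3 * K ≤ M * Real.log (1 / δ) := (div_le_iff₀ hℓ).1 hM
  have h2 : (K : ℝ) * (1 / (2 * M)) ≤ Real.log (1 / δ) := by
    rw [mul_one_div, div_le_iff₀ (by positivity)]
    linarith
  have h4 : 0 ≤ (K : ℝ) / √M := by positivity
  rw [mul_add, mul_one_div (K : ℝ) (√M)]
  linarith

end SamplingError

/-! ### From small sampling error to small suboptimality. -/

section Deterministic

variable {n : ℕ} {X : Type*} [MeasurableSpace X]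

/-- Mixing is assumed only on `Θ`, so the bias bound needs every iterate to lie there. -/
theorem iter_pgdStep_mem {Y : Type*} {Θ : Set (Param n)} (hconv : Convex ℝ Θ)
    (hclosed : IsClosed Θ) {θ₀ : Param n} (hθ₀ : θ₀ ∈ Θ) (t : Y → Param n) (tbar : Param n)
    (lam L : ℝ) {K M : ℕ} (h : Fin K → Fin M → Y) (k : ℕ) :
    iter (pgdStep t tbar lam L Θ) θ₀ h k ∈ Θ := by
  induction k with
  | zero => exact hθ₀
  | succ k ih =>
    by_cases hk : k < K
    · simp only [iter, hk, dite_true]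
      exact (proj_spec ⟨θ₀, hθ₀⟩ hconv hclosed _).1
    · simpa only [iter, hk, dite_false] using ih

/-- Suboptimality of the averaged iterates when the total sampling error is small. -/
theorem negLogLik_average_sub_le {ν : Measure X} [IsFiniteMeasure ν] (hν : ν ≠ 0)
    {t : X → Param n} (ht : Measurable t) {R : ℝ} (hR : 0 < R) (htR : ∀ x, ‖t x‖ ≤ R)
    {lam : ℝ} (hlam : 0 ≤ lam) {D : ℕ} (hD : 0 < D) (z : Fin D → X)
    {Θ : Set (Param n)} (hconv : Convex ℝ Θ) (hclosed : IsClosed Θ)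
    {θstar : Param n} (hstar : θstar ∈ Θ)
    (hmin : ∀ θ ∈ Θ, negLogLik ν t lam z θstar ≤ negLogLik ν t lam z θ)
    {θ₀ : Param n} (hθ₀ : θ₀ ∈ Θ) {Q : Param n → Measure X}
    (hp : ∀ θ, IsProbabilityMeasure (Q θ)) {τ b : ℝ}
    (hmix : ∀ θ ∈ Θ, tvDist (Q θ) (expFamily ν t θ) ≤ τ) {K M : ℕ} (hK : 0 < K) {L : ℝ}
    (hL : 0 < L) (hf : HasLipschitzGradient (negLogLik ν t lam z) L) (h : Fin K → Fin M → X)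
    (hb : ∑ j : Fin K,
      batchError Q t (iter (pgdStep t (empMean t z) lam L Θ) θ₀ h j) (h j) ≤ 2 * R * b) :
    negLogLik ν t lam z
        ((1 / (K : ℝ)) • ∑ k ∈ Finset.Icc 1 K, iter (pgdStep t (empMean t z) lam L Θ) θ₀ h k)
      - negLogLik ν t lam z θstar
      ≤ 8 * R ^ 2 / (K * L) * (L * ‖θ₀ - θstar‖ / (4 * R) + b + K * τ) ^ 2 := by
  have hK' : (0 : ℝ) < K := by exact_mod_cast hK
  have hgrad := hasGradientAt_negLogLik hν ht htR hlam hD z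
  set θ : ℕ → Param n := iter (pgdStep t (empMean t z) lam L Θ) θ₀ h with hθ
  have hmem (k : ℕ) : θ k ∈ Θ := iter_pgdStep_mem hconv hclosed hθ₀ t _ lam L h k
  -- The full gradient error, bias included; the value 0 from `K` on is never read.
  set e : ℕ → Param n := fun k => if hk : k < K then
    (1 / (M : ℝ)) • ∑ i, t (h ⟨k, hk⟩ i) - meanStat ν t (θ k) else 0 with he
  have hstep : ∀ k < K,
      θ (k + 1) = proj Θ (θ k - (1 / L) • (gradLik ν t lam z (θ k) + e k)) := by
    intro k hk
    have h1 : θ (k + 1) = pgdStep t (empMean t z) lam L Θ (θ k) (h ⟨k, hk⟩) := by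
      simp only [hθ, iter, hk, dite_true]
    rw [h1, pgdStep]
    congr 3
    simp only [he, hk, dite_true, gradLik]
    abel
  have hpgd := inexact_projected_gradient hL hconv hclosed (negLogLik_ge hν ht htR hlam hD z)
    (fun θ φ => (hgrad θ).gradient ▸ hf.le_quadratic θ φ) hstar hmin hK hstep
  have herr : ∑ k ∈ Finset.range K, ‖e k‖ ≤ 2 * R * (b + K * τ) := by
    rw [Finset.sum_range]
    calc _ ≤ ∑ j : Fin K, (batchError Q t (θ j) (h j) + 2 * R * τ) := by
          refine Finset.sum_le_sum fun j _ => ?_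
          have := isProbabilityMeasure_expFamily hν ht htR (θ j)
          have hj : e j = ((1 / (M : ℝ)) • ∑ i, t (h j i) - ∫ y, t y ∂(Q (θ j)))
              + (∫ y, t y ∂(Q (θ j)) - ∫ y, t y ∂(expFamily ν t (θ j))) := by
            simp only [he, j.2, dite_true, Fin.eta, meanStat]
            abel
          rw [hj]
          refine (norm_add_le _ _).trans (add_le_add le_rfl
            ((norm_integral_sub_le_tvDist _ _ ht hR.le htR).trans ?_))
          exact mul_le_mul_of_nonneg_left (hmix _ (hmem j)) (by positivity)
      _ ≤ _ := by
          rw [Finset.sum_add_distrib, Finset.sum_const, Finset.card_univ, Fintype.card_fin,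
            nsmul_eq_mul]
          linarith
  refine hpgd.trans ?_
  have h0 : θ 0 = θ₀ := rfl
  rw [h0]
  have hS0 : 0 ≤ ∑ k ∈ Finset.range K, ‖e k‖ := Finset.sum_nonneg fun _ _ => norm_nonneg _
  -- Pulling `4R/L` out of the square gives the prefactor `L/(2K) · 16R²/L² = 8R²/(KL)`.
  calc _ ≤ L / (2 * K) * (‖θ₀ - θstar‖ + 2 / L * (2 * R * (b + K * τ))) ^ 2 := by
        gcongr
    _ = _ := by
        field_simp
        ring

end Deterministic

end MCMCLearning

end

theorem theorem2 {n : ℕ} {X : Type*} [MeasurableSpace X]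
    -- exponential family with bounded sufficient statistics; as `t` is bounded, normalizability
    -- means that the reference measure is finite and nonzero
    (ν : Measure X) [IsFiniteMeasure ν] (hν : ν ≠ 0)
    (t : X → MCMCLearning.Param n) (ht : Measurable t)
    (R₂ : ℝ) (hR₂ : 0 < R₂) (htR : ∀ x, ‖t x‖ ≤ R₂)
    -- data and regularization
    {D : ℕ} (hD : 0 < D) (z : Fin D → X) (lam : ℝ) (hlam : 0 ≤ lam)
    -- constraint set, minimizer, initial point
    (Θ : Set (MCMCLearning.Param n)) (hΘconv : Convex ℝ Θ) (hΘclosed : IsClosed Θ)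
    (θstar : MCMCLearning.Param n) (hstar : θstar ∈ Θ)
    (hmin : ∀ θ ∈ Θ, MCMCLearning.negLogLik ν t lam z θstar ≤ MCMCLearning.negLogLik ν t lam z θ)
    (θ₀ : MCMCLearning.Param n) (hθ₀ : θ₀ ∈ Θ)
    -- Markov chains, mixing geometrically on `Θ`
    (T : MCMCLearning.Param n → Kernel X X) (hT : ∀ θ, IsMarkovKernel (T θ))
    (hTmeas : Measurable fun p : MCMCLearning.Param n × X => T p.1 p.2)
    (C α : ℝ) (hmix : MCMCLearning.FastMixing ν t T Θ C α)
    -- starting distribution, number of chain steps, of iterations and of samples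
    (r : Measure X) [IsProbabilityMeasure r]
    (v K M : ℕ) (hK : 0 < K) (δ : ℝ) (hδ0 : 0 < δ) (hδ1 : δ < 1)
    (hM : 3 * (K : ℝ) / Real.log (1 / δ) ≤ M) :
    MCMCLearning.HasLipschitzGradient (MCMCLearning.negLogLik ν t lam z) (4 * R₂ ^ 2 + lam) ∧
    ∀ L : ℝ, 0 < L → MCMCLearning.HasLipschitzGradient (MCMCLearning.negLogLik ν t lam z) L →
      1 - δ ≤
        (MCMCLearning.samplesLaw
          (MCMCLearning.pgdStep t (MCMCLearning.empMean t z) lam L Θ (M := M)) θ₀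
          (fun θ => MCMCLearning.chainLaw (T θ) v r) K).real
        {h | MCMCLearning.negLogLik ν t lam z
              ((1 / (K : ℝ)) • ∑ k ∈ Finset.Icc 1 K, MCMCLearning.iter
                (MCMCLearning.pgdStep t (MCMCLearning.empMean t z) lam L Θ) θ₀ h k)
            - MCMCLearning.negLogLik ν t lam z θstar
          ≤ 8 * R₂ ^ 2 / (K * L) *
            (L * ‖θ₀ - θstar‖ / (4 * R₂) + Real.log (1 / δ) + K / Real.sqrt M
              + K * C * α ^ v) ^ 2} := by
  refine ⟨MCMCLearning.hasLipschitzGradient_negLogLik hν ht htR hlam hD z, fun L hL hf => ?_⟩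
  have hQ := MCMCLearning.measurable_chainLaw hT hTmeas v r
  have hp (θ : MCMCLearning.Param n) :
      IsProbabilityMeasure (MCMCLearning.chainLaw (T θ) v r) :=
    MCMCLearning.isProbabilityMeasure_chainLaw (T θ) v r
  have hstep := MCMCLearning.measurable_pgdStep ⟨θstar, hstar⟩ hΘconv hΘclosed ht
    (MCMCLearning.empMean t z) lam L M
  have hμ := MCMCLearning.isProbabilityMeasure_samplesLaw (θ₀ := θ₀) hstep hQ hp K
  -- The event of small total sampling error is contained in the target event, with `τ = C * α ^ v`.
  refine (MCMCLearning.samplesLaw_sum_error_le (θ₀ := θ₀) hstep hQ hp ht hR₂ htR hK hδ0 hδ1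
    hM).trans (measureReal_mono fun h hh => ?_)
  refine (MCMCLearning.negLogLik_average_sub_le (b := K / √M + Real.log (1 / δ)) hν ht hR₂ htR hlam
    hD z hΘconv hΘclosed hstar hmin hθ₀ hp (fun θ hθ => hmix θ hθ r inferInstance v) hK hL hf h
    (le_of_le_of_eq hh (by ring))).trans (le_of_eq ?_)
  ring
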